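/- Consider real-valued functions $E$ defined on the states (density matrices) of all finite-dimensional bipartite quantum systems $AB$. For states $\rho$ of $A_1B_1$ and $\sigma$ of $A_2B_2$, regard $\rho\otimes\sigma$ as a state of the bipartite system $(A_1A_2)(B_1B_2)$, and similarly $\rho^{\otimes n}$ as a state of $A^{n}B^{n}$. Call $E$ - convex if $E(t\rho+(1-t)\sigma)\le tE(\rho)+(1-t)E(\sigma)$ for all states $\rho,\sigma$ of the same system and $t\in[0,1]$; - subadditive if $E(\rho\otimes\sigma)\le E(\rho)+E(\sigma)$, and fully additive if $E(\rho\otimes\sigma)=E(\rho)+E(\sigma)$, for all states $\rho,\sigma$ of arbitrary (possibly different) bipartite systems; - fully monotone (under LOCC) if $E(\rho)\ge\sum_i p_iE(\rho_i)$ whenever a protocol of local operations and classical communication (with finitely many rounds and outcomes, possibly changing the local dimensions) applied to $\rho$ yields the state $\rho_i$ with probability $p_i$; - asymptotically continuous if for every $\varepsilon>0$ there is $\delta>0$ such that $|E(\rho)-E(\sigma)|\le\varepsilon\,(1+\log_2\dim(AB))$ for all bipartite systems $AB$ and all states $\rho,\sigma$ of $AB$ with $\|\rho-\sigma\|_1\le\delta$.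 Let $E$ be convex, subadditive, fully monotone and asymptotically continuous. Then the limit $E^\infty(\rho)=\lim_{n\to\infty}\frac1nE(\rho^{\otimes n})$ exists in $\mathbb R$ for every state $\rho$, and the function $E^\infty$ is fully monotone if and only if it is fully additive. In particular, let $E_R(\rho)=\inf_{\sigma\ \mathrm{separable}}S(\rho\|\sigma)$ be the relative entropy of entanglement, where $S(\rho\|\sigma)=\operatorname{tr}\rho(\log_2\rho-\log_2\sigma)$ if $\ker\sigma\subseteq\ker\rho$ and $S(\rho\|\sigma)=+\infty$ otherwise, and a state is separable if it is a finite convex combination of product states. Then the limit $E_R^\infty(\rho)=\lim_{n\to\infty}\frac1nE_R(\rho^{\otimes n})$ exists for every $\rho$, and the asymptotic relative entropy of entanglement $E_R^\infty$ is fully additive if and only if it is fully monotone. -/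

import Mathlib

open scoped Kronecker ComplexOrder

namespace Entanglement

/-- A quantum state on the finite-dimensional Hilbert space `ℂ^X`: a positive semidefinite
complex matrix of trace one. -/
structure State (X : Type) [Fintype X] where
  mat : Matrix X X ℂ
  posSemidef : mat.PosSemidef
  trace_eq_one : mat.trace = 1

/-- The tensor product of a state of the pair `A₁, B₁` and a state of the pair `A₂, B₂`, as a state
of the pair of parties who hold `A₁ ⊗ A₂` and `B₁ ⊗ B₂`. -/
noncomputable def State.tensor {A₁ B₁ A₂ B₂ : Type} [Fintype A₁] [Fintype B₁] [Fintype A₂]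
    [Fintype B₂] (ρ : State (A₁ × B₁)) (σ : State (A₂ × B₂)) :
    State ((A₁ × A₂) × (B₁ × B₂)) where
  mat := (ρ.mat ⊗ₖ σ.mat).submatrix (Equiv.prodProdProdComm A₁ A₂ B₁ B₂)
    (Equiv.prodProdProdComm A₁ A₂ B₁ B₂)
  posSemidef := (ρ.posSemidef.kronecker σ.posSemidef).submatrix _
  trace_eq_one := by
    have h : ((ρ.mat ⊗ₖ σ.mat).submatrix (Equiv.prodProdProdComm A₁ A₂ B₁ B₂)
        (Equiv.prodProdProdComm A₁ A₂ B₁ B₂)).trace = (ρ.mat ⊗ₖ σ.mat).trace :=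
      Equiv.sum_comp (Equiv.prodProdProdComm A₁ A₂ B₁ B₂) fun i => (ρ.mat ⊗ₖ σ.mat) i i
    rw [h, Matrix.trace_kronecker, ρ.trace_eq_one, σ.trace_eq_one, one_mul]

/-- The matrix of `ρ^{⊗n}`, in which the `n` copies of `A` are held by one party and the `n` copies
of `B` by the other. -/
def powMat {A B : Type} (n : ℕ) (M : Matrix (A × B) (A × B) ℂ) :
    Matrix ((Fin n → A) × (Fin n → B)) ((Fin n → A) × (Fin n → B)) ℂ :=
  Matrix.of fun x y => ∏ k, M (x.1 k, x.2 k) (y.1 k, y.2 k)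

theorem powMat_posSemidef {A B : Type} [Fintype A] [Fintype B] (n : ℕ)
    {M : Matrix (A × B) (A × B) ℂ} (hM : M.PosSemidef) : (powMat n M).PosSemidef := by
  classical
  have key : ∀ s : Finset (Fin n),
      (Matrix.of fun x y : (Fin n → A) × (Fin n → B) =>
        ∏ k ∈ s, M (x.1 k, x.2 k) (y.1 k, y.2 k)).PosSemidef := by
    intro s
    induction s using Finset.induction_on with
    | empty =>
      have h := Matrix.posSemidef_vecMulVec_self_star
        (fun _ : (Fin n → A) × (Fin n → B) => (1 : ℂ))
      convert h using 1
      ext x y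
      simp [Matrix.vecMulVec_apply]
    | insert k s hk ih =>
      have h := (hM.submatrix
        (fun x : (Fin n → A) × (Fin n → B) => (x.1 k, x.2 k))).hadamard ih
      have e : (Matrix.of fun x y : (Fin n → A) × (Fin n → B) =>
          ∏ k ∈ insert k s, M (x.1 k, x.2 k) (y.1 k, y.2 k)) =
          (M.submatrix (fun x : (Fin n → A) × (Fin n → B) => (x.1 k, x.2 k))
            (fun x : (Fin n → A) × (Fin n → B) => (x.1 k, x.2 k))).hadamard
          (Matrix.of fun x y : (Fin n → A) × (Fin n → B) =>
            ∏ k ∈ s, M (x.1 k, x.2 k) (y.1 k, y.2 k)) := by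
        ext x y
        simp [Finset.prod_insert hk]
      rw [e]
      exact h
  exact key Finset.univ

theorem powMat_trace {A B : Type} [Fintype A] [Fintype B] (n : ℕ)
    (M : Matrix (A × B) (A × B) ℂ) : (powMat n M).trace = M.trace ^ n := by
  classical
  have h := Equiv.sum_comp (Equiv.arrowProdEquivProdArrow (Fin n) (fun _ => A) (fun _ => B))
    (fun x => powMat n M x x)
  have h2 := Finset.prod_univ_sum (fun _ : Fin n => (Finset.univ : Finset (A × B)))
    (fun _ x => M x x)
  rw [Matrix.trace]
  simp only [Matrix.diag_apply]
  rw [← h]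
  simp only [Finset.prod_const, Finset.card_univ, Fintype.card_fin, Fintype.piFinset_univ] at h2
  rw [Matrix.trace]
  simp only [Matrix.diag_apply]
  rw [h2]
  rfl

/-- `ρ^{⊗n}` as a bipartite state. -/
def State.pow {A B : Type} [Fintype A] [Fintype B] (ρ : State (A × B)) (n : ℕ) :
    State ((Fin n → A) × (Fin n → B)) where
  mat := powMat n ρ.mat
  posSemidef := powMat_posSemidef n ρ.posSemidef
  trace_eq_one := by rw [powMat_trace, ρ.trace_eq_one, one_pow]

/-- `IsLOCC Φ`: the family `Φ i`, indexed by the final classical outcome `i`, of (unnormalised)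
state transformations is implemented by a protocol of local operations and classical communication
with finitely many rounds. A protocol either stops and declares an outcome `j`, or one of the
parties performs a generalised measurement with operators `K x`, `∑ x, (K x)ᴴ * K x = 1`, possibly
into a space of another dimension, and announces the result `x`, upon which the parties continue
with a protocol that may depend on `x`. Different branches of the protocol may declare the same
outcome; the rest of the classical information is then forgotten, so that general local quantum
instruments, partial traces and deterministic LOCC maps (`I` a one-point type) are included. -/
inductive IsLOCC {I A' B' : Type} [DecidableEq I] : ∀ {A B : Type},
    (I → Matrix (A × B) (A × B) ℂ → Matrix (A' × B') (A' × B') ℂ) → Prop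
  | output (j : I) : IsLOCC (A := A') (B := B') fun i M => if i = j then M else 0
  | alice {A B A₁ X : Type} [Fintype A] [DecidableEq A] [Fintype B] [DecidableEq B] [Fintype A₁]
      [Fintype X] (K : X → Matrix A₁ A ℂ) (hK : ∑ x, (K x).conjTranspose * K x = 1)
      (Φ : X → I → Matrix (A₁ × B) (A₁ × B) ℂ → Matrix (A' × B') (A' × B') ℂ)
      (hΦ : ∀ x, IsLOCC (Φ x)) :
      IsLOCC fun i (M : Matrix (A × B) (A × B) ℂ) =>
        ∑ x, Φ x i ((K x ⊗ₖ (1 : Matrix B B ℂ)) * M *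
          (K x ⊗ₖ (1 : Matrix B B ℂ)).conjTranspose)
  | bob {A B B₁ X : Type} [Fintype A] [DecidableEq A] [Fintype B] [DecidableEq B] [Fintype B₁]
      [Fintype X] (K : X → Matrix B₁ B ℂ) (hK : ∑ x, (K x).conjTranspose * K x = 1)
      (Φ : X → I → Matrix (A × B₁) (A × B₁) ℂ → Matrix (A' × B') (A' × B') ℂ)
      (hΦ : ∀ x, IsLOCC (Φ x)) :
      IsLOCC fun i (M : Matrix (A × B) (A × B) ℂ) =>
        ∑ x, Φ x i (((1 : Matrix A A ℂ) ⊗ₖ K x) * M *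
          ((1 : Matrix A A ℂ) ⊗ₖ K x).conjTranspose)

/-- A real-valued function of the states of all finite-dimensional bipartite systems. -/
abbrev BipartiteFunction : Type 1 :=
  ∀ (A B : Type) [Fintype A] [Fintype B], State (A × B) → ℝ

/-- Convexity: `E(t ρ + (1 - t) σ) ≤ t E(ρ) + (1 - t) E(σ)`. -/
def IsConvex (E : BipartiteFunction) : Prop :=
  ∀ (A B : Type) [Fintype A] [Fintype B] (ρ σ τ : State (A × B)) (t : ℝ), 0 ≤ t → t ≤ 1 →
    τ.mat = (t : ℂ) • ρ.mat + ((1 - t : ℝ) : ℂ) • σ.mat →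
    E A B τ ≤ t * E A B ρ + (1 - t) * E A B σ

/-- Subadditivity: `E(ρ ⊗ σ) ≤ E(ρ) + E(σ)`. -/
def IsSubadditive (E : BipartiteFunction) : Prop :=
  ∀ (A₁ B₁ A₂ B₂ : Type) [Fintype A₁] [Fintype B₁] [Fintype A₂] [Fintype B₂]
    (ρ : State (A₁ × B₁)) (σ : State (A₂ × B₂)),
    E (A₁ × A₂) (B₁ × B₂) (ρ.tensor σ) ≤ E A₁ B₁ ρ + E A₂ B₂ σ

/-- Full additivity: `E(ρ ⊗ σ) = E(ρ) + E(σ)`. -/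
def IsFullyAdditive (E : BipartiteFunction) : Prop :=
  ∀ (A₁ B₁ A₂ B₂ : Type) [Fintype A₁] [Fintype B₁] [Fintype A₂] [Fintype B₂]
    (ρ : State (A₁ × B₁)) (σ : State (A₂ × B₂)),
    E (A₁ × A₂) (B₁ × B₂) (ρ.tensor σ) = E A₁ B₁ ρ + E A₂ B₂ σ

/-- Full monotonicity: `∑ i, p i * E(σ i) ≤ E(ρ)` whenever an LOCC protocol applied to `ρ` yields,
with probability `p i`, the outcome `i` and the state `σ i`. (By `trace (σ i) = 1` the hypothesis
says that `p i = trace (Φ i ρ)`; the choice of `σ i` is immaterial when `p i = 0`.) -/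
def IsFullyMonotone (E : BipartiteFunction) : Prop :=
  ∀ (A B A' B' I : Type) [Fintype A] [Fintype B] [Fintype A'] [Fintype B'] [Fintype I]
    [DecidableEq I]
    (Φ : I → Matrix (A × B) (A × B) ℂ → Matrix (A' × B') (A' × B') ℂ), IsLOCC Φ →
    ∀ (ρ : State (A × B)) (p : I → ℝ) (σ : I → State (A' × B')),
      (∀ i, Φ i ρ.mat = (p i : ℂ) • (σ i).mat) →
      ∑ i, p i * E A' B' (σ i) ≤ E A B ρ

open Classical in
/-- The trace norm `tr √(Mᴴ M)`. -/
noncomputable def traceNorm {X : Type} [Fintype X] (M : Matrix X X ℂ) : ℝ :=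
  (cfc Real.sqrt (M.conjTranspose * M)).trace.re

/-- Asymptotic continuity: `(E(ρ) - E(σ)) / (1 + log₂ dim)` tends to zero with the trace distance
of `ρ` and `σ`, uniformly over all states and over all (dimensions of) bipartite systems. -/
def IsAsymptoticallyContinuous (E : BipartiteFunction) : Prop :=
  ∀ ε : ℝ, 0 < ε → ∃ δ : ℝ, 0 < δ ∧
    ∀ (A B : Type) [Fintype A] [Fintype B] (ρ σ : State (A × B)),
      traceNorm (ρ.mat - σ.mat) ≤ δ →
      |E A B ρ - E A B σ| ≤ ε * (1 + Real.logb 2 (Fintype.card (A × B)))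

/-- The limit that defines the regularisation of `E` exists (in `ℝ`) at every state. -/
def RegularizationExists (E : BipartiteFunction) : Prop :=
  ∀ (A B : Type) [Fintype A] [Fintype B] (ρ : State (A × B)),
    ∃ l : ℝ, Filter.Tendsto (fun n : ℕ => E (Fin n → A) (Fin n → B) (ρ.pow n) / n)
      Filter.atTop (nhds l)

/-- The regularisation `E^∞(ρ) = lim E(ρ^{⊗n}) / n`. -/
noncomputable def regularization (E : BipartiteFunction) : BipartiteFunction :=
  fun A B _ _ ρ => Filter.limUnder Filter.atTop
    fun n : ℕ => E (Fin n → A) (Fin n → B) (ρ.pow n) / n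

/-- Separable states: finite convex combinations of product states. -/
def IsSeparable {A B : Type} [Fintype A] [Fintype B] (σ : State (A × B)) : Prop :=
  ∃ (m : ℕ) (p : Fin m → ℝ) (α : Fin m → State A) (β : Fin m → State B),
    (∀ i, 0 ≤ p i) ∧ ∑ i, p i = 1 ∧ σ.mat = ∑ i, (p i : ℂ) • ((α i).mat ⊗ₖ (β i).mat)

open Classical in
/-- The quantum relative entropy `S(ρ‖σ) = tr ρ (log₂ ρ - log₂ σ)`, with value `+∞` unless the
kernel of `σ` is contained in that of `ρ`. The logarithm is defined by the functional calculus with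
the value `0` on the kernel, which implements the usual convention `0 log 0 = 0`. -/
noncomputable def relativeEntropy {X : Type} [Fintype X] (ρ σ : State X) : EReal :=
  if ∀ v : X → ℂ, σ.mat.mulVec v = 0 → ρ.mat.mulVec v = 0 then
    (((ρ.mat * (cfc (Real.logb 2) ρ.mat - cfc (Real.logb 2) σ.mat)).trace.re : ℝ) : EReal)
  else ⊤

/-- The relative entropy of entanglement: the infimum of `S(ρ‖σ)` over all separable `σ`, which is
finite since the maximally mixed state is separable and of full rank. -/
noncomputable def relativeEntropyOfEntanglement : BipartiteFunction :=
  fun A B _ _ ρ => (⨅ (σ : State (A × B)) (_ : IsSeparable σ), relativeEntropy ρ σ).toReal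

end Entanglement

/-!
A subadditive and fully monotone function `E` is nonnegative, so that Fekete's lemma gives the
regularization `E^∞`, which is subadditive and satisfies `E^∞ ≤ E`.

If `E^∞` is additive, apply the protocol to the copies in `ρ^{⊗n}` one after the other. Monotonicity
of `E` bounds `E(ρ^{⊗n})` from below by the mean of `E`, hence of `E^∞`, over the products of the
possible outputs, and by additivity that mean is `n ∑ pᵢ E^∞(ρᵢ)` (`IsFullyMonotone.le_pow_tensor`).

If `E^∞` is monotone, consider the equal mixture `ω` of `ρ` and `σ`, placed on orthogonal local
subspaces. A local measurement distinguishes the two components, so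
`(E^∞(ρ) + E^∞(σ)) / 2 ≤ E^∞(ω)`. On the other hand `ω^{⊗n}` is a mixture of products of `k` copies
of `ρ` and `n - k` copies of `σ`, where `k` deviates from `n / 2` by `O(√n)` in the mean; convexity
and subadditivity of `E` give `E^∞(ω) ≤ E^∞(ρ ⊗ σ) / 2` (`regularization_mix_le`). The law of large
numbers that this needs is contained in an induction on `n` with a quadratic bound
(`mix_pow_tensor_le`).

For the relative entropy of entanglement it remains to verify convexity, subadditivity and full
monotonicity. They follow from
joint convexity of the relative entropy, its monotonicity under quantum instruments, and its
additivity on tensor products, together with the fact that local protocols have product Kraus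
operators and so preserve separability. The first two are derived from one comparison principle
(`sum_relEnt_le_of_quad`): with `rᵢ, eᵢ` and `sⱼ, fⱼ` the spectral data of `M` and `N`,
`S(M‖N) = ∑ᵢⱼ |⟨eᵢ, fⱼ⟩|² rᵢ (log rᵢ - log sⱼ)` is the limit of
`∫₀ᵀ ∑ᵢⱼ |⟨eᵢ, fⱼ⟩|² rᵢ² / (sⱼ + t rᵢ) dt - tr M log T`, and the integrand is the maximum over all
matrices `Z` of `2 Re tr(Zᴴ M) - tr(Zᴴ N Z) - t tr(Z M Zᴴ)`. This expression is linear in `(M, N)`,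
which gives convexity, and by the Kadison–Schwarz inequality the value at `Z` for the outputs of an
instrument is at most the value for its input at the image of `Z` under the adjoint map.
-/

namespace Entanglement

open Matrix Filter Topology

/-! ### Local operations on the two parties -/

/-- Monotonicity under deterministic local channels, given by Kraus operators `K` of the first and
`L` of the second party. -/
theorem IsFullyMonotone.le_of_local {E : BipartiteFunction} (hE : IsFullyMonotone E)
    {A B A' B' X Y : Type} [Fintype A] [DecidableEq A] [Fintype B] [DecidableEq B]
    [Fintype A'] [Fintype B'] [Fintype X] [Fintype Y]
    (K : X → Matrix A' A ℂ) (hK : ∑ x, (K x)ᴴ * K x = 1)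
    (L : Y → Matrix B' B ℂ) (hL : ∑ y, (L y)ᴴ * L y = 1)
    (ρ : State (A × B)) (ρ' : State (A' × B'))
    (h : ρ'.mat = ∑ x, ∑ y, (K x ⊗ₖ L y) * ρ.mat * (K x ⊗ₖ L y)ᴴ) :
    E A' B' ρ' ≤ E A B ρ := by
  classical
  have hΦ := IsLOCC.alice (I := Unit) (A' := A') (B' := B') (B := B) K hK _
    (fun _ => IsLOCC.bob (I := Unit) (A := A') L hL _ (fun _ => IsLOCC.output ()))
  have := hE A B A' B' Unit _ hΦ ρ (fun _ => 1) (fun _ => ρ') ?_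
  · simpa using this
  · rintro ⟨⟩
    simp only [if_true, Complex.ofReal_one, one_smul, h]
    refine Finset.sum_congr rfl fun x _ => Finset.sum_congr rfl fun y _ => ?_
    have e : K x ⊗ₖ L y = ((1 : Matrix A' A' ℂ) ⊗ₖ L y) * (K x ⊗ₖ (1 : Matrix B B ℂ)) := by
      rw [← mul_kronecker_mul]; simp
    rw [e, conjTranspose_mul]
    simp only [Matrix.mul_assoc]

open Classical in
/-- The matrix of the linear map `ℂ^X → ℂ^Y` that sends the basis vector `x` to the basis vector
`w x`. -/
noncomputable def basisMap {X Y : Type} (w : X → Y) : Matrix Y X ℂ :=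
  Matrix.of fun y x => if y = w x then 1 else 0

theorem basisMap_apply_apply {X Y : Type} [DecidableEq X] {w : X → Y} (hw : Function.Injective w) (x x' : X) :
    basisMap w (w x) x' = if x' = x then 1 else 0 := by
  classical
  simp only [basisMap, Matrix.of_apply]
  exact if_congr (hw.eq_iff.trans eq_comm) rfl rfl

theorem basisMap_conjTranspose_mul_self {X Y : Type} [Fintype Y] [DecidableEq X]
    {w : X → Y} (hw : Function.Injective w) : (basisMap w)ᴴ * basisMap w = 1 := by
  ext i j
  rw [Matrix.mul_apply, Finset.sum_eq_single (w i)]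
  · simp [basisMap_apply_apply hw, Matrix.one_apply, eq_comm]
  · intro y _ hy
    simp [basisMap, hy]
  · simp

theorem basisMap_kronecker {A B A' B' : Type} (u : A → A') (v : B → B') :
    basisMap u ⊗ₖ basisMap v = basisMap (Prod.map u v) := by
  ext ⟨a', b'⟩ ⟨a, b⟩
  simp only [basisMap, kroneckerMap_apply, Matrix.of_apply, Prod.map_apply, Prod.mk.injEq]
  split_ifs <;> simp_all

theorem basisMap_conj_apply {X Y : Type} [Fintype X] {w : X → Y}
    (hw : Function.Injective w) (M : Matrix X X ℂ) (x y : X) :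
    (basisMap w * M * (basisMap w)ᴴ) (w x) (w y) = M x y := by
  classical
  simp [Matrix.mul_apply, basisMap_apply_apply hw]

/-- The state `ρ`, regarded as a state of a larger space by means of an injection of the standard
bases. -/
noncomputable def State.embed {X Y : Type} [Fintype X] [Fintype Y] (w : X → Y)
    (hw : Function.Injective w) (ρ : State X) : State Y where
  mat := basisMap w * ρ.mat * (basisMap w)ᴴ
  posSemidef := ρ.posSemidef.mul_mul_conjTranspose_same _
  trace_eq_one := by
    classical
    rw [Matrix.trace_mul_comm, ← Matrix.mul_assoc, basisMap_conjTranspose_mul_self hw, one_mul,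
      ρ.trace_eq_one]

theorem State.nonempty {X : Type} [Fintype X] (ρ : State X) : Nonempty X := by
  by_contra h
  rw [not_nonempty_iff] at h
  have := ρ.trace_eq_one
  simp [Matrix.trace] at this

open Classical in
/-- Kraus operators of a channel that undoes the embedding `basisMap u`: the adjoint of
`basisMap u`, together with operators that reset the complement of its range to the basis
vector `a₀`. -/
noncomputable def unembedKraus {A A' : Type} (u : A → A') (a₀ : A) :
    Option A' → Matrix A A' ℂ
  | none => (basisMap u)ᴴ
  | some a' => if a' ∈ Set.range u then 0 else Matrix.single a₀ a' 1

theorem sum_unembedKraus {A A' : Type} [Fintype A] [Fintype A'] [DecidableEq A'] {u : A → A'}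
    (hu : Function.Injective u) (a₀ : A) :
    ∑ x, (unembedKraus u a₀ x)ᴴ * unembedKraus u a₀ x = 1 := by
  classical
  rw [Fintype.sum_option]
  ext i j
  have h1 : ∀ a' : A', ((unembedKraus u a₀ (some a'))ᴴ * unembedKraus u a₀ (some a')) i j
      = if a' = i then (if i = j ∧ i ∉ Set.range u then 1 else 0) else 0 := by
    intro a'
    by_cases h : a' ∈ Set.range u
    · simp only [unembedKraus, if_pos h]
      by_cases h' : a' = i
      · subst h'; simp [h]
      · simp [h']
    · simp only [unembedKraus, if_neg h, Matrix.conjTranspose_single, star_one,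
        Matrix.single_mul_single_same, mul_one, Matrix.single_apply]
      by_cases h' : a' = i
      · subst h'; simp [h]
      · simp [h']
  have h2 : (basisMap u * (basisMap u)ᴴ) i j = if i = j ∧ i ∈ Set.range u then 1 else 0 := by
    rw [Matrix.mul_apply]
    by_cases hi : i ∈ Set.range u
    · obtain ⟨a, rfl⟩ := hi
      rw [Finset.sum_eq_single a]
      · simp [basisMap, eq_comm]
      · intro x _ hx
        simp [basisMap_apply_apply hu, hx]
      · simp
    · rw [if_neg (fun h => hi h.2)]
      refine Finset.sum_eq_zero fun a _ => ?_
      rw [basisMap, Matrix.of_apply, if_neg (fun h => hi ⟨a, h.symm⟩), zero_mul]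
  rw [Matrix.add_apply, Matrix.sum_apply, Finset.sum_congr rfl fun a' _ => h1 a']
  simp only [unembedKraus, Matrix.conjTranspose_conjTranspose, h2, Finset.sum_ite_eq',
    Finset.mem_univ, if_true, Matrix.one_apply]
  by_cases hij : i = j <;> by_cases hi : i ∈ Set.range u <;> simp [hij, hi] <;> simp_all

theorem unembedKraus_some_mul {A A' : Type} [Fintype A'] (u : A → A')
    (a₀ : A) (a' : A') : unembedKraus u a₀ (some a') * basisMap u = 0 := by
  classical
  by_cases h : a' ∈ Set.range u
  · simp [unembedKraus, h]
  · ext i j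
    have : a' ≠ u j := fun hj => h ⟨j, hj.symm⟩
    simp only [unembedKraus, if_neg h, Matrix.mul_apply, Matrix.zero_apply]
    refine Finset.sum_eq_zero fun k _ => ?_
    simp only [Matrix.single_apply, basisMap, Matrix.of_apply]
    by_cases hk : a' = k
    · subst hk; simp [this]
    · simp [hk]

/-- Embedding the local spaces into larger ones is a reversible local operation. -/
theorem IsFullyMonotone.embed_eq {E : BipartiteFunction} (hE : IsFullyMonotone E)
    {A B A' B' : Type} [Fintype A] [Fintype B] [Fintype A'] [Fintype B']
    {u : A → A'} {v : B → B'} (hu : Function.Injective u) (hv : Function.Injective v)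
    (ρ : State (A × B)) (ρ' : State (A' × B'))
    (h : ρ'.mat = basisMap (Prod.map u v) * ρ.mat * (basisMap (Prod.map u v))ᴴ) :
    E A' B' ρ' = E A B ρ := by
  classical
  rw [← basisMap_kronecker] at h
  obtain ⟨a₀, b₀⟩ := ρ.nonempty
  apply le_antisymm
  · refine hE.le_of_local (X := Unit) (Y := Unit) (fun _ => basisMap u) ?_ (fun _ => basisMap v) ?_
      ρ ρ' ?_
    · simp [basisMap_conjTranspose_mul_self hu]
    · simp [basisMap_conjTranspose_mul_self hv]
    · simpa using h
  · refine hE.le_of_local (unembedKraus u a₀) (sum_unembedKraus hu a₀) (unembedKraus v b₀)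
      (sum_unembedKraus hv b₀) ρ' ρ ?_
    have key : ∀ x y, (unembedKraus u a₀ x ⊗ₖ unembedKraus v b₀ y) * ρ'.mat *
        (unembedKraus u a₀ x ⊗ₖ unembedKraus v b₀ y)ᴴ =
        ((unembedKraus u a₀ x * basisMap u) ⊗ₖ (unembedKraus v b₀ y * basisMap v)) * ρ.mat *
        ((unembedKraus u a₀ x * basisMap u) ⊗ₖ (unembedKraus v b₀ y * basisMap v))ᴴ := by
      intro x y
      rw [h, mul_kronecker_mul, conjTranspose_mul]
      simp only [Matrix.mul_assoc]
    simp only [key, Fintype.sum_option, unembedKraus_some_mul]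
    simp [unembedKraus, basisMap_conjTranspose_mul_self hu, basisMap_conjTranspose_mul_self hv]

/-- Bijections of the local index sets leave a monotone function unchanged; all rearrangements of
tensor factors are instances. -/
theorem IsFullyMonotone.relabel_eq {E : BipartiteFunction} (hE : IsFullyMonotone E)
    {A B A' B' : Type} [Fintype A] [Fintype B] [Fintype A'] [Fintype B']
    (u : A ≃ A') (v : B ≃ B') (ρ : State (A × B)) (ρ' : State (A' × B'))
    (h : ∀ x y, ρ'.mat (u x.1, v x.2) (u y.1, v y.2) = ρ.mat x y) :
    E A' B' ρ' = E A B ρ := by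
  refine hE.embed_eq u.injective v.injective ρ ρ' ?_
  ext x y
  obtain ⟨x, rfl⟩ := (u.prodCongr v).surjective x
  obtain ⟨y, rfl⟩ := (u.prodCongr v).surjective y
  exact (h x y).trans (basisMap_conj_apply (u.injective.prodMap v.injective) ρ.mat x y).symm

/-- The state of a system with trivial local spaces. -/
def State.trivial : State (Unit × Unit) where
  mat := 1
  posSemidef := Matrix.PosSemidef.one
  trace_eq_one := by simp [Matrix.trace]

theorem IsFullyMonotone.trivial_le {E : BipartiteFunction} (hE : IsFullyMonotone E)
    {A B : Type} [Fintype A] [Fintype B] (ρ : State (A × B)) :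
    E Unit Unit State.trivial ≤ E A B ρ := by
  classical
  refine hE.le_of_local (fun a : A => Matrix.single () a 1) ?_ (fun b : B => Matrix.single () b 1)
    ?_ ρ _ ?_
  · simp only [conjTranspose_single, star_one, single_mul_single_same, mul_one]
    ext i j
    simp [Matrix.sum_apply, Matrix.single_apply, Matrix.one_apply, ite_and]
  · simp only [conjTranspose_single, star_one, single_mul_single_same, mul_one]
    ext i j
    simp [Matrix.sum_apply, Matrix.single_apply, Matrix.one_apply, ite_and]
  · ext ⟨⟨⟩, ⟨⟩⟩ ⟨⟨⟩, ⟨⟩⟩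
    have := ρ.trace_eq_one
    rw [Matrix.trace, Fintype.sum_prod_type] at this
    simp only [Matrix.sum_apply, State.trivial]
    refine (Matrix.one_apply_eq _).trans (this.symm.trans ?_)
    refine Finset.sum_congr rfl fun a _ => Finset.sum_congr rfl fun b _ => ?_
    rw [single_kronecker_single, mul_one, Matrix.diag_apply, conjTranspose_single, star_one]
    have : (Matrix.single ((), ()) (a, b) (1 : ℂ) * ρ.mat *
        Matrix.single (a, b) ((), ()) (1 : ℂ)) ((), ()) ((), ()) = ρ.mat (a, b) (a, b) := by simp
    exact this.symm

theorem State.tensor_apply {A₁ B₁ A₂ B₂ : Type} [Fintype A₁] [Fintype B₁] [Fintype A₂]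
    [Fintype B₂] (ρ : State (A₁ × B₁)) (σ : State (A₂ × B₂)) (x y : (A₁ × A₂) × (B₁ × B₂)) :
    (ρ.tensor σ).mat x y = ρ.mat (x.1.1, x.2.1) (y.1.1, y.2.1) *
      σ.mat (x.1.2, x.2.2) (y.1.2, y.2.2) := rfl

theorem State.pow_apply {A B : Type} [Fintype A] [Fintype B] (ρ : State (A × B)) (n : ℕ)
    (x y : (Fin n → A) × (Fin n → B)) :
    (ρ.pow n).mat x y = ∏ k, ρ.mat (x.1 k, x.2 k) (y.1 k, y.2 k) := rfl

/-- A monotone subadditive function is nonnegative: its minimum `c`, attained at the trivial state,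
satisfies `c ≤ c + c`. -/
theorem IsFullyMonotone.nonneg {E : BipartiteFunction} (hE : IsFullyMonotone E)
    (hS : IsSubadditive E) {A B : Type} [Fintype A] [Fintype B] (ρ : State (A × B)) :
    0 ≤ E A B ρ := by
  have h1 := hS _ _ _ _ State.trivial State.trivial
  have h2 := hE.trivial_le (State.trivial.tensor State.trivial)
  have h3 := hE.trivial_le ρ
  linarith

/-! ### Protocols next to an untouched system, and Kraus operators -/

/-- The tensor product of operators, arranged as in `State.tensor`. -/
def tensorMat {A₁ B₁ A₂ B₂ A₁' B₁' A₂' B₂' : Type} (S : Matrix (A₁ × B₁) (A₁' × B₁') ℂ)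
    (T : Matrix (A₂ × B₂) (A₂' × B₂') ℂ) :
    Matrix ((A₁ × A₂) × (B₁ × B₂)) ((A₁' × A₂') × (B₁' × B₂')) ℂ :=
  (S ⊗ₖ T).submatrix (Equiv.prodProdProdComm A₁ A₂ B₁ B₂) (Equiv.prodProdProdComm A₁' A₂' B₁' B₂')

theorem tensorMat_apply {A₁ B₁ A₂ B₂ A₁' B₁' A₂' B₂' : Type} (S : Matrix (A₁ × B₁) (A₁' × B₁') ℂ)
    (T : Matrix (A₂ × B₂) (A₂' × B₂') ℂ) (x y) :
    tensorMat S T x y = S (x.1.1, x.2.1) (y.1.1, y.2.1) * T (x.1.2, x.2.2) (y.1.2, y.2.2) := rfl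

theorem tensorMat_mul {A₁ B₁ A₂ B₂ A₁' B₁' A₂' B₂' A₁'' B₁'' A₂'' B₂'' : Type}
    [Fintype A₁'] [Fintype B₁'] [Fintype A₂'] [Fintype B₂']
    (S : Matrix (A₁ × B₁) (A₁' × B₁') ℂ) (T : Matrix (A₂ × B₂) (A₂' × B₂') ℂ)
    (S' : Matrix (A₁' × B₁') (A₁'' × B₁'') ℂ) (T' : Matrix (A₂' × B₂') (A₂'' × B₂'') ℂ) :
    tensorMat S T * tensorMat S' T' = tensorMat (S * S') (T * T') := by
  rw [tensorMat, tensorMat, submatrix_mul_equiv, ← mul_kronecker_mul, tensorMat]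

theorem tensorMat_conjTranspose {A₁ B₁ A₂ B₂ A₁' B₁' A₂' B₂' : Type}
    (S : Matrix (A₁ × B₁) (A₁' × B₁') ℂ) (T : Matrix (A₂ × B₂) (A₂' × B₂') ℂ) :
    (tensorMat S T)ᴴ = tensorMat Sᴴ Tᴴ := by
  rw [tensorMat, conjTranspose_submatrix, conjTranspose_kronecker, tensorMat]

theorem tensorMat_kronecker {A₁ B₁ A₂ B₂ A₁' B₁' A₂' B₂' : Type}
    (P : Matrix A₁ A₁' ℂ) (Q : Matrix B₁ B₁' ℂ) (R : Matrix A₂ A₂' ℂ) (S : Matrix B₂ B₂' ℂ) :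
    tensorMat (P ⊗ₖ Q) (R ⊗ₖ S) = (P ⊗ₖ R) ⊗ₖ (Q ⊗ₖ S) := by
  ext x y
  simp only [tensorMat_apply, kroneckerMap_apply]
  ring

theorem tensorMat_sum_right {A₁ B₁ A₂ B₂ A₁' B₁' A₂' B₂' X : Type} [Fintype X]
    (S : Matrix (A₁ × B₁) (A₁' × B₁') ℂ) (T : X → Matrix (A₂ × B₂) (A₂' × B₂') ℂ) :
    tensorMat S (∑ x, T x) = ∑ x, tensorMat S (T x) := by
  ext
  simp [tensorMat_apply, Matrix.sum_apply, Finset.mul_sum]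

theorem tensorMat_smul_right {A₁ B₁ A₂ B₂ A₁' B₁' A₂' B₂' : Type} (c : ℂ)
    (S : Matrix (A₁ × B₁) (A₁' × B₁') ℂ) (T : Matrix (A₂ × B₂) (A₂' × B₂') ℂ) :
    tensorMat S (c • T) = c • tensorMat S T := by
  ext
  simp only [tensorMat_apply, Matrix.smul_apply, smul_eq_mul]
  ring

theorem tensorMat_add_right {A₁ B₁ A₂ B₂ A₁' B₁' A₂' B₂' : Type}
    (S : Matrix (A₁ × B₁) (A₁' × B₁') ℂ) (T T' : Matrix (A₂ × B₂) (A₂' × B₂') ℂ) :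
    tensorMat S (T + T') = tensorMat S T + tensorMat S T' := by
  ext
  simp only [tensorMat_apply, Matrix.add_apply, mul_add]

theorem kronecker_sum {m n p q X : Type} [Fintype X] (S : Matrix m n ℂ) (T : X → Matrix p q ℂ) :
    ∑ x, S ⊗ₖ T x = S ⊗ₖ ∑ x, T x := by
  ext
  simp [Matrix.sum_apply, Finset.mul_sum]

theorem sum_kronecker {m n p q X : Type} [Fintype X] (S : X → Matrix m n ℂ) (T : Matrix p q ℂ) :
    ∑ x, S x ⊗ₖ T = (∑ x, S x) ⊗ₖ T := by
  ext
  simp [Matrix.sum_apply, Finset.sum_mul]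

/-- The parties may carry out a protocol while each of them holds an additional system, which is
left untouched. -/
theorem IsLOCC.tensor_left {I A' B' : Type} [DecidableEq I] (C D : Type) [Fintype C]
    [DecidableEq C] [Fintype D] [DecidableEq D] {A B : Type}
    {Φ : I → Matrix (A × B) (A × B) ℂ → Matrix (A' × B') (A' × B') ℂ} (h : IsLOCC Φ) :
    ∃ Ψ : I → Matrix ((C × A) × (D × B)) ((C × A) × (D × B)) ℂ →
        Matrix ((C × A') × (D × B')) ((C × A') × (D × B')) ℂ,
      IsLOCC Ψ ∧ ∀ i (T : Matrix (C × D) (C × D) ℂ) M,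
        Ψ i (tensorMat T M) = tensorMat T (Φ i M) := by
  induction h with
  | output j =>
    refine ⟨_, IsLOCC.output j, fun i T M => ?_⟩
    dsimp only
    split_ifs
    · rfl
    · ext; simp [tensorMat_apply]
  | @alice A B A₁ X _ _ _ _ _ _ K hK Φ hΦ ih =>
    choose Ψ hΨ hΨ' using ih
    refine ⟨_, IsLOCC.alice (fun x => (1 : Matrix C C ℂ) ⊗ₖ K x) ?_ Ψ hΨ, fun i T M => ?_⟩
    · simp only [conjTranspose_kronecker, ← mul_kronecker_mul, conjTranspose_one, mul_one]
      rw [kronecker_sum, hK, one_kronecker_one]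
    · rw [tensorMat_sum_right]
      refine Finset.sum_congr rfl fun x _ => ?_
      rw [← hΨ', ← one_kronecker_one (α := ℂ) (m := D) (n := B), ← tensorMat_kronecker,
        one_kronecker_one, tensorMat_mul, tensorMat_conjTranspose, tensorMat_mul]
      simp
  | @bob A B B₁ X _ _ _ _ _ _ K hK Φ hΦ ih =>
    choose Ψ hΨ hΨ' using ih
    refine ⟨_, IsLOCC.bob (fun x => (1 : Matrix D D ℂ) ⊗ₖ K x) ?_ Ψ hΨ, fun i T M => ?_⟩
    · simp only [conjTranspose_kronecker, ← mul_kronecker_mul, conjTranspose_one, mul_one]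
      rw [kronecker_sum, hK, one_kronecker_one]
    · rw [tensorMat_sum_right]
      refine Finset.sum_congr rfl fun x _ => ?_
      rw [← hΨ', ← one_kronecker_one (α := ℂ) (m := C) (n := A), ← tensorMat_kronecker,
        one_kronecker_one, tensorMat_mul, tensorMat_conjTranspose, tensorMat_mul]
      simp

/-- A local protocol is a quantum instrument whose Kraus operators are product operators, each of
them contributing to the outcome that labels it. -/
theorem IsLOCC.exists_kraus {I A' B' : Type} [DecidableEq I] [Fintype A'] [Fintype B'] {A B : Type}
    {Φ : I → Matrix (A × B) (A × B) ℂ → Matrix (A' × B') (A' × B') ℂ} (h : IsLOCC Φ) :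
    ∀ [Fintype A] [Fintype B] [DecidableEq A] [DecidableEq B],
    ∃ (Z : Type) (_ : Fintype Z) (l : Z → I) (a : Z → Matrix A' A ℂ) (b : Z → Matrix B' B ℂ),
      (∀ i M, Φ i M =
        ∑ z, if l z = i then (a z ⊗ₖ b z) * M * (a z ⊗ₖ b z)ᴴ else 0) ∧
      ∑ z, (a z ⊗ₖ b z)ᴴ * (a z ⊗ₖ b z) = 1 := by
  classical
  induction h with
  | output j =>
    intro iA' iB' _ _
    refine ⟨Unit, inferInstance, fun _ => j, fun _ => 1, fun _ => 1, fun i M => ?_, ?_⟩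
    · simp only [one_kronecker_one, conjTranspose_one, Finset.univ_unique, Finset.sum_const,
        Finset.card_singleton, one_smul, eq_comm (a := j)]
      split_ifs
      · exact ((Matrix.mul_one _).trans (Matrix.one_mul _)).symm
      · rfl
    · simp
  | @alice A B A₁ X iA dA iB dB _ _ K hK Φ hΦ ih =>
    intro iA' iB' dA' dB'
    obtain rfl := Subsingleton.elim iA iA'
    obtain rfl := Subsingleton.elim iB iB'
    obtain rfl := Subsingleton.elim dA dA'
    obtain rfl := Subsingleton.elim dB dB'
    choose Z hZ l a b h1 h2 using fun x => @ih x _ _ _ _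
    have e : ∀ x (z : Z x), (a x z * K x) ⊗ₖ b x z =
        (a x z ⊗ₖ b x z) * (K x ⊗ₖ (1 : Matrix B B ℂ)) := by
      intro x z
      rw [← mul_kronecker_mul, Matrix.mul_one]
    refine ⟨Σ x, Z x, inferInstance, fun z => l z.1 z.2, fun z => a z.1 z.2 * K z.1,
      fun z => b z.1 z.2, fun i M => ?_, ?_⟩
    · rw [Fintype.sum_sigma]
      refine Finset.sum_congr rfl fun x _ => ?_
      rw [h1]
      refine Finset.sum_congr rfl fun z _ => ?_
      dsimp only
      rw [e, conjTranspose_mul]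
      simp only [Matrix.mul_assoc]
    · rw [Fintype.sum_sigma]
      dsimp only
      have : ∀ x, ∑ z, ((a x z * K x) ⊗ₖ b x z)ᴴ * ((a x z * K x) ⊗ₖ b x z) =
          ((K x)ᴴ * K x) ⊗ₖ (1 : Matrix B B ℂ) := by
        intro x
        have : ∀ z, ((a x z * K x) ⊗ₖ b x z)ᴴ * ((a x z * K x) ⊗ₖ b x z) =
            (K x ⊗ₖ (1 : Matrix B B ℂ))ᴴ * ((a x z ⊗ₖ b x z)ᴴ * (a x z ⊗ₖ b x z)) *
              (K x ⊗ₖ (1 : Matrix B B ℂ)) := by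
          intro z
          rw [e, conjTranspose_mul]
          simp only [Matrix.mul_assoc]
        rw [Finset.sum_congr rfl fun z _ => this z, ← Matrix.sum_mul, ← Matrix.mul_sum, h2,
          Matrix.mul_one, conjTranspose_kronecker, ← mul_kronecker_mul]
        simp
      rw [Finset.sum_congr rfl fun x _ => this x]
      rw [sum_kronecker, hK, one_kronecker_one]
  | @bob A B B₁ X iA dA iB dB _ _ K hK Φ hΦ ih =>
    intro iA' iB' dA' dB'
    obtain rfl := Subsingleton.elim iA iA'
    obtain rfl := Subsingleton.elim iB iB'
    obtain rfl := Subsingleton.elim dA dA'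
    obtain rfl := Subsingleton.elim dB dB'
    choose Z hZ l a b h1 h2 using fun x => @ih x _ _ _ _
    have e : ∀ x (z : Z x), a x z ⊗ₖ (b x z * K x) =
        (a x z ⊗ₖ b x z) * ((1 : Matrix A A ℂ) ⊗ₖ K x) := by
      intro x z
      rw [← mul_kronecker_mul, Matrix.mul_one]
    refine ⟨Σ x, Z x, inferInstance, fun z => l z.1 z.2, fun z => a z.1 z.2,
      fun z => b z.1 z.2 * K z.1, fun i M => ?_, ?_⟩
    · rw [Fintype.sum_sigma]
      refine Finset.sum_congr rfl fun x _ => ?_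
      rw [h1]
      refine Finset.sum_congr rfl fun z _ => ?_
      dsimp only
      rw [e, conjTranspose_mul]
      simp only [Matrix.mul_assoc]
    · rw [Fintype.sum_sigma]
      dsimp only
      have : ∀ x, ∑ z, (a x z ⊗ₖ (b x z * K x))ᴴ * (a x z ⊗ₖ (b x z * K x)) =
          (1 : Matrix A A ℂ) ⊗ₖ ((K x)ᴴ * K x) := by
        intro x
        have : ∀ z, (a x z ⊗ₖ (b x z * K x))ᴴ * (a x z ⊗ₖ (b x z * K x)) =
            ((1 : Matrix A A ℂ) ⊗ₖ K x)ᴴ * ((a x z ⊗ₖ b x z)ᴴ * (a x z ⊗ₖ b x z)) *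
              ((1 : Matrix A A ℂ) ⊗ₖ K x) := by
          intro z
          rw [e, conjTranspose_mul]
          simp only [Matrix.mul_assoc]
        rw [Finset.sum_congr rfl fun z _ => this z, ← Matrix.sum_mul, ← Matrix.mul_sum, h2,
          Matrix.mul_one, conjTranspose_kronecker, ← mul_kronecker_mul]
        simp
      rw [Finset.sum_congr rfl fun x _ => this x]
      rw [kronecker_sum, hK, one_kronecker_one]

theorem IsLOCC.posSemidef {I A B A' B' : Type} [DecidableEq I] [Fintype A] [Fintype B]
    [Fintype A'] [Fintype B']
    {Φ : I → Matrix (A × B) (A × B) ℂ → Matrix (A' × B') (A' × B') ℂ} (h : IsLOCC Φ) (i : I)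
    {M : Matrix (A × B) (A × B) ℂ} (hM : M.PosSemidef) : (Φ i M).PosSemidef := by
  classical
  obtain ⟨Z, _, l, a, b, h1, -⟩ := h.exists_kraus
  rw [h1]
  refine posSemidef_sum _ fun z _ => ?_
  split_ifs
  · exact hM.mul_mul_conjTranspose_same _
  · exact .zero

theorem IsLOCC.sum_trace {I A B A' B' : Type} [Fintype I] [DecidableEq I] [Fintype A] [Fintype B]
    [Fintype A'] [Fintype B']
    {Φ : I → Matrix (A × B) (A × B) ℂ → Matrix (A' × B') (A' × B') ℂ} (h : IsLOCC Φ)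
    (M : Matrix (A × B) (A × B) ℂ) : ∑ i, (Φ i M).trace = M.trace := by
  classical
  obtain ⟨Z, _, l, a, b, h1, h2⟩ := h.exists_kraus
  simp only [h1, Matrix.trace_sum]
  rw [Finset.sum_comm]
  have : ∀ z, ∑ i, (if l z = i then (a z ⊗ₖ b z) * M * (a z ⊗ₖ b z)ᴴ else 0).trace =
      ((a z ⊗ₖ b z)ᴴ * (a z ⊗ₖ b z) * M).trace := by
    intro z
    rw [Finset.sum_eq_single (l z) (fun i _ hi => by rw [if_neg (Ne.symm hi), Matrix.trace_zero])
      (by simp), if_pos rfl, Matrix.trace_mul_comm, Matrix.mul_assoc]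
  rw [Finset.sum_congr rfl fun z _ => this z, ← Matrix.trace_sum, ← Finset.sum_mul, h2,
    Matrix.one_mul]

/-! ### Tensor powers and the regularization -/

section TensorPowers

variable {E : BipartiteFunction} {A B C D A₁ B₁ : Type} [Fintype A] [Fintype B] [Fintype C]
  [Fintype D] [Fintype A₁] [Fintype B₁]

theorem IsFullyMonotone.tensor_assoc (hE : IsFullyMonotone E) (ρ : State (A × B))
    (σ : State (C × D)) (τ : State (A₁ × B₁)) :
    E _ _ ((ρ.tensor σ).tensor τ) = E _ _ (ρ.tensor (σ.tensor τ)) :=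
  (hE.relabel_eq (Equiv.prodAssoc _ _ _) (Equiv.prodAssoc _ _ _) _ _ fun x y => by
    simp [State.tensor_apply, mul_assoc]).symm

/-- The bijection that moves the last factor of `(Fin n → X) × Y × X` to the front of the
tuple. -/
def consEquiv (X Y : Type) (n : ℕ) : ((Fin n → X) × Y) × X ≃ (Fin (n + 1) → X) × Y where
  toFun p := (Fin.cons p.2 p.1.1, p.1.2)
  invFun q := ((Fin.tail q.1, q.2), q.1 0)
  left_inv p := by simp
  right_inv q := by simp

theorem IsFullyMonotone.pow_succ_tensor (hE : IsFullyMonotone E) (ρ : State (A × B))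
    (τ : State (C × D)) (n : ℕ) :
    E _ _ ((ρ.pow (n + 1)).tensor τ) = E _ _ (((ρ.pow n).tensor τ).tensor ρ) :=
  hE.relabel_eq (consEquiv A C n) (consEquiv B D n) _ _ fun x y => by
    simp only [State.tensor_apply, State.pow_apply, consEquiv, Equiv.coe_fn_mk,
      Fin.prod_univ_succ, Fin.cons_zero, Fin.cons_succ]
    ring

theorem IsFullyMonotone.pow_zero_tensor (hE : IsFullyMonotone E) (ρ : State (A × B))
    (τ : State (C × D)) : E _ _ ((ρ.pow 0).tensor τ) = E _ _ τ :=
  hE.relabel_eq (Equiv.uniqueProd C (Fin 0 → A)).symm (Equiv.uniqueProd D (Fin 0 → B)).symm _ _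
    fun x y => by simp [State.tensor_apply, State.pow_apply]

theorem IsFullyMonotone.tensor_pow_zero (hE : IsFullyMonotone E) (ρ : State (A × B))
    (τ : State (C × D)) : E _ _ (τ.tensor (ρ.pow 0)) = E _ _ τ :=
  hE.relabel_eq (Equiv.prodUnique C (Fin 0 → A)).symm (Equiv.prodUnique D (Fin 0 → B)).symm _ _
    fun x y => by simp [State.tensor_apply, State.pow_apply]

theorem IsFullyMonotone.pow_one (hE : IsFullyMonotone E) (ρ : State (A × B)) :
    E _ _ (ρ.pow 1) = E _ _ ρ :=
  hE.relabel_eq (Equiv.funUnique (Fin 1) A).symm (Equiv.funUnique (Fin 1) B).symm _ _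
    fun x y => by simp [State.pow_apply]

theorem IsFullyMonotone.pow_add (hE : IsFullyMonotone E) (ρ : State (A × B)) (m n : ℕ) :
    E _ _ (ρ.pow (m + n)) = E _ _ ((ρ.pow m).tensor (ρ.pow n)) :=
  hE.relabel_eq (Fin.appendEquiv m n) (Fin.appendEquiv m n) _ _
    fun x y => by simp [State.tensor_apply, State.pow_apply, Fin.appendEquiv, Fin.prod_univ_add]

theorem IsFullyMonotone.tensor_pow (hE : IsFullyMonotone E) (ρ : State (A × B))
    (σ : State (C × D)) (n : ℕ) :
    E _ _ ((ρ.tensor σ).pow n) = E _ _ ((ρ.pow n).tensor (σ.pow n)) :=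
  hE.relabel_eq (Equiv.arrowProdEquivProdArrow (Fin n) (fun _ => A) (fun _ => C)).symm
    (Equiv.arrowProdEquivProdArrow (Fin n) (fun _ => B) (fun _ => D)).symm _ _
    fun x y => by
      simp [State.tensor_apply, State.pow_apply, Equiv.arrowProdEquivProdArrow,
        Finset.prod_mul_distrib]

theorem IsFullyMonotone.pow_tensor_pow_add_le (hE : IsFullyMonotone E) (hS : IsSubadditive E)
    (ρ : State (A × B)) (σ : State (C × D)) (k l k' l' : ℕ) :
    E _ _ ((ρ.pow (k + k')).tensor (σ.pow (l + l'))) ≤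
      E _ _ ((ρ.pow k).tensor (σ.pow l)) + E _ _ ((ρ.pow k').tensor (σ.pow l')) := by
  refine le_of_eq_of_le ?_ (hS _ _ _ _ ((ρ.pow k).tensor (σ.pow l))
    ((ρ.pow k').tensor (σ.pow l')))
  refine hE.relabel_eq
    ((Equiv.prodProdProdComm _ _ _ _).trans
      ((Fin.appendEquiv k k').prodCongr (Fin.appendEquiv l l')))
    ((Equiv.prodProdProdComm _ _ _ _).trans
      ((Fin.appendEquiv k k').prodCongr (Fin.appendEquiv l l'))) _ _ fun x y => ?_
  simp only [State.tensor_apply, State.pow_apply, Fin.appendEquiv, Equiv.trans_apply,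
    Equiv.prodCongr_apply, Prod.map_apply, Equiv.coe_fn_mk, Fin.prod_univ_add,
    Equiv.prodProdProdComm_apply, Fin.append_left, Fin.append_right]
  ring

/-- Monotonicity under a protocol that leaves an additional system untouched. -/
theorem IsFullyMonotone.tensor_left (hE : IsFullyMonotone E) {A' B' I : Type} [Fintype A']
    [Fintype B'] [Fintype I] [DecidableEq I]
    {Φ : I → Matrix (A × B) (A × B) ℂ → Matrix (A' × B') (A' × B') ℂ} (hΦ : IsLOCC Φ)
    (τ : State (C × D)) {ρ : State (A × B)} {p : I → ℝ} {σ : I → State (A' × B')}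
    (h : ∀ i, Φ i ρ.mat = (p i : ℂ) • (σ i).mat) :
    ∑ i, p i * E _ _ (τ.tensor (σ i)) ≤ E _ _ (τ.tensor ρ) := by
  classical
  obtain ⟨Ψ, hΨ, hΨ'⟩ := hΦ.tensor_left C D
  refine hE _ _ _ _ I Ψ hΨ _ p _ fun i => ?_
  change Ψ i (tensorMat τ.mat ρ.mat) = (p i : ℂ) • tensorMat τ.mat (σ i).mat
  rw [hΨ', h, tensorMat_smul_right]

end TensorPowers

section Regularization

variable {E : BipartiteFunction} {A B C D : Type} [Fintype A] [Fintype B] [Fintype C]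
  [Fintype D]

theorem IsFullyMonotone.subadditive_pow (hM : IsFullyMonotone E) (hS : IsSubadditive E)
    (ρ : State (A × B)) : Subadditive fun n : ℕ => E _ _ (ρ.pow n) := by
  intro m n
  dsimp only
  rw [hM.pow_add]
  exact hS _ _ _ _ _ _

theorem IsFullyMonotone.bddBelow_pow (hM : IsFullyMonotone E) (hS : IsSubadditive E)
    (ρ : State (A × B)) :
    BddBelow (Set.range fun n : ℕ => E _ _ (ρ.pow n) / n) := by
  refine ⟨0, ?_⟩
  rintro _ ⟨n, rfl⟩
  exact div_nonneg (hM.nonneg hS _) n.cast_nonneg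

theorem IsFullyMonotone.regularizationExists (hM : IsFullyMonotone E) (hS : IsSubadditive E) :
    RegularizationExists E := fun _ _ _ _ ρ =>
  ⟨_, (hM.subadditive_pow hS ρ).tendsto_lim (hM.bddBelow_pow hS ρ)⟩

theorem IsFullyMonotone.tendsto_regularization (hM : IsFullyMonotone E) (hS : IsSubadditive E)
    (ρ : State (A × B)) :
    Tendsto (fun n : ℕ => E _ _ (ρ.pow n) / n) atTop (𝓝 (regularization E A B ρ)) :=
  tendsto_nhds_limUnder (hM.regularizationExists hS A B ρ)

theorem IsFullyMonotone.regularization_le (hM : IsFullyMonotone E) (hS : IsSubadditive E)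
    (ρ : State (A × B)) : regularization E A B ρ ≤ E A B ρ := by
  rw [tendsto_nhds_unique (hM.tendsto_regularization hS ρ)
    ((hM.subadditive_pow hS ρ).tendsto_lim (hM.bddBelow_pow hS ρ))]
  refine ((hM.subadditive_pow hS ρ).lim_le_div (hM.bddBelow_pow hS ρ) one_ne_zero).trans ?_
  rw [hM.pow_one, Nat.cast_one, div_one]

theorem IsFullyMonotone.regularization_nonneg (hM : IsFullyMonotone E) (hS : IsSubadditive E)
    (ρ : State (A × B)) : 0 ≤ regularization E A B ρ :=
  ge_of_tendsto' (hM.tendsto_regularization hS ρ) fun n =>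
    div_nonneg (hM.nonneg hS _) n.cast_nonneg

theorem IsFullyMonotone.regularization_tensor_le (hM : IsFullyMonotone E) (hS : IsSubadditive E)
    (ρ : State (A × B)) (σ : State (C × D)) :
    regularization E _ _ (ρ.tensor σ) ≤ regularization E _ _ ρ + regularization E _ _ σ := by
  refine le_of_tendsto_of_tendsto' (hM.tendsto_regularization hS _)
    ((hM.tendsto_regularization hS ρ).add (hM.tendsto_regularization hS σ)) fun n => ?_
  rw [hM.tensor_pow, ← add_div]
  exact div_le_div_of_nonneg_right (hS _ _ _ _ _ _) n.cast_nonneg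

/-- Additivity of the regularization lets the protocol be applied to the copies of `ρ` one after
the other: each application replaces one copy by one of the states `σ i`, whose contribution to the
regularization of the final product state is separated off. -/
theorem IsFullyMonotone.le_pow_tensor (hM : IsFullyMonotone E) (hS : IsSubadditive E)
    (hA : IsFullyAdditive (regularization E)) {A' B' I : Type} [Fintype A']
    [Fintype B'] [Fintype I] [DecidableEq I]
    {Φ : I → Matrix (A × B) (A × B) ℂ → Matrix (A' × B') (A' × B') ℂ} (hΦ : IsLOCC Φ)
    {ρ : State (A × B)} {p : I → ℝ} {σ : I → State (A' × B')}
    (h : ∀ i, Φ i ρ.mat = (p i : ℂ) • (σ i).mat) (hp : ∀ i, 0 ≤ p i) (hp1 : ∑ i, p i = 1) (n : ℕ) :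
    ∀ {C D : Type} [Fintype C] [Fintype D] (τ : State (C × D)),
    n * ∑ i, p i * regularization E _ _ (σ i) + regularization E _ _ τ ≤
      E _ _ ((ρ.pow n).tensor τ) := by
  induction n with
  | zero =>
    intro C D _ _ τ
    rw [hM.pow_zero_tensor]
    simpa using hM.regularization_le hS τ
  | succ n ih =>
    intro C D _ _ τ
    rw [hM.pow_succ_tensor]
    refine le_trans ?_ (hM.tensor_left hΦ _ h)
    simp only [hM.tensor_assoc]
    refine le_trans (le_of_eq ?_)
      (Finset.sum_le_sum fun i _ => mul_le_mul_of_nonneg_left (ih (τ.tensor (σ i))) (hp i))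
    have e : ∀ i, p i * (n * ∑ i, p i * regularization E _ _ (σ i) +
        regularization E _ _ (τ.tensor (σ i))) =
        p i * (n * ∑ i, p i * regularization E _ _ (σ i) + regularization E _ _ τ) +
          p i * regularization E _ _ (σ i) := by
      intro i
      rw [hA]
      ring
    rw [Finset.sum_congr rfl fun i _ => e i, Finset.sum_add_distrib, ← Finset.sum_mul, hp1]
    push_cast
    ring

theorem IsLOCC.prob_nonneg {A' B' I : Type} [Fintype A']
    [Fintype B'] [DecidableEq I]
    {Φ : I → Matrix (A × B) (A × B) ℂ → Matrix (A' × B') (A' × B') ℂ} (hΦ : IsLOCC Φ)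
    {ρ : State (A × B)} {p : I → ℝ} {σ : I → State (A' × B')}
    (h : ∀ i, Φ i ρ.mat = (p i : ℂ) • (σ i).mat) (i : I) : 0 ≤ p i := by
  have := (hΦ.posSemidef i ρ.posSemidef).trace_nonneg
  rw [h, Matrix.trace_smul, (σ i).trace_eq_one, smul_eq_mul, mul_one] at this
  exact_mod_cast this

theorem IsLOCC.sum_prob {A' B' I : Type} [Fintype A']
    [Fintype B'] [Fintype I] [DecidableEq I]
    {Φ : I → Matrix (A × B) (A × B) ℂ → Matrix (A' × B') (A' × B') ℂ} (hΦ : IsLOCC Φ)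
    {ρ : State (A × B)} {p : I → ℝ} {σ : I → State (A' × B')}
    (h : ∀ i, Φ i ρ.mat = (p i : ℂ) • (σ i).mat) : ∑ i, p i = 1 := by
  have := hΦ.sum_trace ρ.mat
  simp only [h, Matrix.trace_smul, State.trace_eq_one, smul_eq_mul, mul_one] at this
  exact_mod_cast this

theorem IsFullyMonotone.regularization_of_additive (hM : IsFullyMonotone E) (hS : IsSubadditive E)
    (hA : IsFullyAdditive (regularization E)) : IsFullyMonotone (regularization E) := by
  intro A B A' B' I _ _ _ _ _ _ Φ hΦ ρ p σ h
  refine ge_of_tendsto (hM.tendsto_regularization hS ρ) ?_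
  filter_upwards [eventually_gt_atTop 0] with n hn
  rw [le_div_iff₀ (by exact_mod_cast hn), mul_comm]
  have := hM.le_pow_tensor hS hA hΦ h (hΦ.prob_nonneg h) (hΦ.sum_prob h) n (ρ.pow 0)
  rw [hM.tensor_pow_zero] at this
  linarith [hM.regularization_nonneg hS (ρ.pow 0)]

/-! ### Superadditivity of a monotone regularization -/

/-- `ρ` as a state on the first local summands. -/
noncomputable def State.inl (C D : Type) [Fintype C] [Fintype D] (ρ : State (A × B)) :
    State ((A ⊕ C) × (B ⊕ D)) :=
  ρ.embed (Prod.map (Sum.inl : A → A ⊕ C) (Sum.inl : B → B ⊕ D))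
      (Sum.inl_injective.prodMap Sum.inl_injective)

/-- `σ` as a state on the second local summands. -/
noncomputable def State.inr (A B : Type) [Fintype A] [Fintype B] (σ : State (C × D)) :
    State ((A ⊕ C) × (B ⊕ D)) :=
  σ.embed (Prod.map (Sum.inr : C → A ⊕ C) (Sum.inr : D → B ⊕ D))
      (Sum.inr_injective.prodMap Sum.inr_injective)

/-- The equal mixture of `ρ` and `σ`, placed on orthogonal local subspaces. -/
noncomputable def State.mix (ρ : State (A × B)) (σ : State (C × D)) :
    State ((A ⊕ C) × (B ⊕ D)) where
  mat := (2⁻¹ : ℂ) • (ρ.inl C D).mat + (2⁻¹ : ℂ) • (σ.inr A B).mat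
  posSemidef := by
    have h : (0 : ℂ) ≤ 2⁻¹ := by
      rw [show (2⁻¹ : ℂ) = ((2⁻¹ : ℝ) : ℂ) by push_cast; rfl]
      exact_mod_cast (by norm_num : (0 : ℝ) ≤ 2⁻¹)
    exact ((State.posSemidef _).smul h).add ((State.posSemidef _).smul h)
  trace_eq_one := by
    rw [trace_add, trace_smul, trace_smul, State.trace_eq_one, State.trace_eq_one]
    norm_num

theorem IsFullyMonotone.inl_eq (hE : IsFullyMonotone E) (ρ : State (A × B)) :
    E _ _ (ρ.inl C D) = E _ _ ρ :=
  hE.embed_eq Sum.inl_injective Sum.inl_injective _ _ rfl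

theorem IsFullyMonotone.inr_eq (hE : IsFullyMonotone E) (σ : State (C × D)) :
    E _ _ (σ.inr A B) = E _ _ σ :=
  hE.embed_eq Sum.inr_injective Sum.inr_injective _ _ rfl

theorem basisMap_one {X : Type} [DecidableEq X] : (1 : Matrix X X ℂ) = basisMap id := by
  ext i j
  simp [basisMap, Matrix.one_apply]

theorem IsFullyMonotone.tensor_embed (hE : IsFullyMonotone E) {A' B' A₁ B₁ : Type} [Fintype A']
    [Fintype B'] [Fintype A₁] [Fintype B₁] {u : A → A'} {v : B → B'} (hu : Function.Injective u)
    (hv : Function.Injective v) (τ : State (A₁ × B₁)) (ρ : State (A × B)) :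
    E _ _ (τ.tensor (ρ.embed (Prod.map u v) (hu.prodMap hv))) = E _ _ (τ.tensor ρ) := by
  classical
  refine hE.embed_eq (Function.injective_id.prodMap hu) (Function.injective_id.prodMap hv) _ _ ?_
  change tensorMat τ.mat (basisMap (Prod.map u v) * ρ.mat * (basisMap (Prod.map u v))ᴴ) =
    basisMap _ * tensorMat τ.mat ρ.mat * (basisMap _)ᴴ
  have : basisMap (Prod.map (Prod.map (id : A₁ → A₁) u) (Prod.map (id : B₁ → B₁) v)) =
      tensorMat (1 : Matrix (A₁ × B₁) (A₁ × B₁) ℂ) (basisMap (Prod.map u v)) := by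
    rw [← one_kronecker_one, ← basisMap_kronecker, ← basisMap_kronecker, ← basisMap_kronecker,
      ← basisMap_kronecker, tensorMat_kronecker, basisMap_one, basisMap_one]
  rw [this, tensorMat_mul, tensorMat_conjTranspose, tensorMat_mul]
  simp

theorem IsConvex.tensor_mix_le (hC : IsConvex E) {A₁ B₁ : Type} [Fintype A₁] [Fintype B₁]
    (τ : State (A₁ × B₁)) (ρ : State (A × B)) (σ : State (C × D)) :
    E _ _ (τ.tensor (ρ.mix σ)) ≤
      (E _ _ (τ.tensor (ρ.inl C D)) + E _ _ (τ.tensor (σ.inr A B))) / 2 := by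
  have := hC _ _ (τ.tensor (ρ.inl C D)) (τ.tensor (σ.inr A B)) (τ.tensor (ρ.mix σ)) 2⁻¹
    (by norm_num) (by norm_num) ?_
  · linarith
  · change tensorMat τ.mat ((2⁻¹ : ℂ) • (ρ.inl C D).mat + (2⁻¹ : ℂ) • (σ.inr A B).mat) =
      _ • tensorMat τ.mat (ρ.inl C D).mat + _ • tensorMat τ.mat (σ.inr A B).mat
    rw [tensorMat_add_right, tensorMat_smul_right, tensorMat_smul_right]
    norm_num

/-- A local projective measurement tells the two components of the mixture apart. -/
theorem IsFullyMonotone.half_add_half_le_mix (hE : IsFullyMonotone E) (ρ : State (A × B))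
    (σ : State (C × D)) : (E _ _ ρ + E _ _ σ) / 2 ≤ E _ _ (ρ.mix σ) := by
  classical
  let P : Bool → Matrix (A ⊕ C) (A ⊕ C) ℂ := fun b =>
    Matrix.diagonal fun s => if s.isLeft = b then 1 else 0
  have hP : ∑ b, (P b)ᴴ * P b = 1 := by
    simp only [P, diagonal_conjTranspose, diagonal_mul_diagonal, Fintype.sum_bool, diagonal_add]
    rw [← diagonal_one]
    congr 1
    ext s
    rcases s with s | s <;> simp
  have hΦ := IsLOCC.alice (I := Bool) (A' := A ⊕ C) (B' := B ⊕ D) (B := B ⊕ D) P hP _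
    (fun b => IsLOCC.output b)
  have hl : ∀ b, (P b ⊗ₖ (1 : Matrix (B ⊕ D) (B ⊕ D) ℂ)) *
      basisMap (Prod.map (Sum.inl : A → A ⊕ C) (Sum.inl : B → B ⊕ D)) =
      if b = true then basisMap (Prod.map (Sum.inl : A → A ⊕ C) (Sum.inl : B → B ⊕ D)) else 0 := by
    intro b
    have : P b * basisMap (Sum.inl : A → A ⊕ C) =
        if b = true then basisMap (Sum.inl : A → A ⊕ C) else 0 := by
      ext s a
      rcases b <;> rcases s with s | s <;> simp [P, basisMap]
    rw [← basisMap_kronecker, ← mul_kronecker_mul, this, Matrix.one_mul]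
    split_ifs <;> simp
  have hr : ∀ b, (P b ⊗ₖ (1 : Matrix (B ⊕ D) (B ⊕ D) ℂ)) *
      basisMap (Prod.map (Sum.inr : C → A ⊕ C) (Sum.inr : D → B ⊕ D)) =
      if b = true then 0 else basisMap (Prod.map (Sum.inr : C → A ⊕ C) (Sum.inr : D → B ⊕ D)) := by
    intro b
    have : P b * basisMap (Sum.inr : C → A ⊕ C) =
        if b = true then 0 else basisMap (Sum.inr : C → A ⊕ C) := by
      ext s a
      rcases b <;> rcases s with s | s <;> simp [P, basisMap]
    rw [← basisMap_kronecker, ← mul_kronecker_mul, this, Matrix.one_mul]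
    split_ifs <;> simp
  have key : ∀ b, (P b ⊗ₖ (1 : Matrix (B ⊕ D) (B ⊕ D) ℂ)) * (ρ.mix σ).mat *
      (P b ⊗ₖ (1 : Matrix (B ⊕ D) (B ⊕ D) ℂ))ᴴ =
      (2⁻¹ : ℂ) • (if b = true then ρ.inl C D else σ.inr A B).mat := by
    intro b
    have : ∀ (L M N : Matrix ((A ⊕ C) × (B ⊕ D)) ((A ⊕ C) × (B ⊕ D)) ℂ),
      L * ((2⁻¹ : ℂ) • M + (2⁻¹ : ℂ) • N) * Lᴴ =
        (2⁻¹ : ℂ) • (L * M * Lᴴ) + (2⁻¹ : ℂ) • (L * N * Lᴴ) := by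
      intro L M N
      simp [Matrix.mul_add, Matrix.add_mul]
    have hc : ∀ {X : Type} [Fintype X] (L : Matrix ((A ⊕ C) × (B ⊕ D)) ((A ⊕ C) × (B ⊕ D)) ℂ)
        (J : Matrix ((A ⊕ C) × (B ⊕ D)) X ℂ) (M : Matrix X X ℂ),
        L * (J * M * Jᴴ) * Lᴴ = (L * J) * M * (L * J)ᴴ := by
      intro X _ L J M
      simp only [conjTranspose_mul, Matrix.mul_assoc]
    rw [State.mix, this]
    simp only [State.inl, State.inr, State.embed, hc, hl, hr]
    rcases b <;> simp
  have := hE _ _ _ _ Bool _ hΦ (ρ.mix σ) (fun _ => 2⁻¹)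
    (fun b => if b = true then ρ.inl C D else σ.inr A B) ?_
  · simp only [Fintype.sum_bool, if_true, Bool.false_eq_true, if_false, hE.inl_eq, hE.inr_eq]
      at this
    linarith
  · intro b
    simp only [Finset.sum_ite_eq, Finset.mem_univ, if_true]
    rw [key]
    norm_num

theorem IsFullyMonotone.pow_tensor_add_left (hE : IsFullyMonotone E) {A' B' : Type} [Fintype A']
    [Fintype B'] (ω : State (A' × B')) (ρ : State (A × B)) (σ : State (C × D)) (j k l : ℕ) :
    E _ _ (((ω.pow j).tensor ((ρ.pow k).tensor (σ.pow l))).tensor ρ) =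
      E _ _ ((ω.pow j).tensor ((ρ.pow (k + 1)).tensor (σ.pow l))) :=
  (hE.relabel_eq
    ((Equiv.prodAssoc _ _ _).trans ((Equiv.refl _).prodCongr (consEquiv A (Fin l → C) k)))
    ((Equiv.prodAssoc _ _ _).trans ((Equiv.refl _).prodCongr (consEquiv B (Fin l → D) k)))
    _ _ fun x y => by
      simp only [State.tensor_apply, State.pow_apply, consEquiv, Equiv.coe_fn_mk,
        Equiv.trans_apply, Equiv.prodCongr_apply, Equiv.prodAssoc_apply, Prod.map_apply,
        Equiv.refl_apply, Fin.prod_univ_succ, Fin.cons_zero, Fin.cons_succ]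
      ring).symm

theorem IsFullyMonotone.pow_tensor_add_right (hE : IsFullyMonotone E) {A' B' : Type} [Fintype A']
    [Fintype B'] (ω : State (A' × B')) (ρ : State (A × B)) (σ : State (C × D)) (j k l : ℕ) :
    E _ _ (((ω.pow j).tensor ((ρ.pow k).tensor (σ.pow l))).tensor σ) =
      E _ _ ((ω.pow j).tensor ((ρ.pow k).tensor (σ.pow (l + 1)))) :=
  (hE.relabel_eq
    ((Equiv.prodAssoc _ _ _).trans ((Equiv.refl _).prodCongr
      (((Equiv.prodComm _ _).prodCongr (Equiv.refl _)).trans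
        ((consEquiv C (Fin k → A) l).trans (Equiv.prodComm _ _)))))
    ((Equiv.prodAssoc _ _ _).trans ((Equiv.refl _).prodCongr
      (((Equiv.prodComm _ _).prodCongr (Equiv.refl _)).trans
        ((consEquiv D (Fin k → B) l).trans (Equiv.prodComm _ _)))))
    _ _ fun x y => by
      simp only [State.tensor_apply, State.pow_apply, consEquiv, Equiv.coe_fn_mk,
        Equiv.trans_apply, Equiv.prodCongr_apply, Equiv.prodAssoc_apply, Prod.map_apply,
        Equiv.prodComm_apply, Prod.swap_prod_mk, Prod.fst_swap, Prod.snd_swap,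
        Equiv.refl_apply, Fin.prod_univ_succ, Fin.cons_zero, Fin.cons_succ]
      ring).symm

/-- Each copy of the mixture turns into a copy of `ρ` or of `σ` with equal probability, so that the
difference of the numbers of copies performs a symmetric random walk, and the expectation of its
square increases by `1` in each step. -/
theorem mix_pow_tensor_le (hC : IsConvex E) (hM : IsFullyMonotone E) (ρ : State (A × B))
    (σ : State (C × D)) {a b c : ℝ}
    (h : ∀ k l : ℕ, E _ _ ((ρ.pow k).tensor (σ.pow l)) ≤ a * (k + l) + b + c * ((k : ℝ) - l) ^ 2)
    (j : ℕ) : ∀ k l : ℕ, E _ _ (((ρ.mix σ).pow j).tensor ((ρ.pow k).tensor (σ.pow l))) ≤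
      a * (k + l + j) + b + c * (((k : ℝ) - l) ^ 2 + j) := by
  induction j with
  | zero =>
    intro k l
    rw [hM.pow_zero_tensor]
    simpa using h k l
  | succ j ih =>
    intro k l
    rw [hM.pow_succ_tensor]
    refine (IsConvex.tensor_mix_le hC _ ρ σ).trans ?_
    rw [State.inl, State.inr, hM.tensor_embed Sum.inl_injective Sum.inl_injective,
      hM.tensor_embed Sum.inr_injective Sum.inr_injective, hM.pow_tensor_add_left,
      hM.pow_tensor_add_right]
    have h1 := ih (k + 1) l
    have h2 := ih k (l + 1)
    push_cast at h1 h2 ⊢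
    linarith

/-- Pair off as many copies of `ρ` and `σ` as possible; subadditivity charges each of the remaining
copies the value of `E`. -/
theorem IsFullyMonotone.pow_tensor_pow_le (hM : IsFullyMonotone E) (hS : IsSubadditive E)
    (ρ : State (A × B)) (σ : State (C × D)) {a b : ℝ} (ha : 0 ≤ a)
    (h : ∀ m : ℕ, E _ _ ((ρ.tensor σ).pow m) ≤ a * m + b) (k l : ℕ) :
    E _ _ ((ρ.pow k).tensor (σ.pow l)) ≤
      a * (k + l) / 2 + b + (E _ _ ρ + E _ _ σ) * |(k : ℝ) - l| := by
  have hρ := hM.nonneg hS ρ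
  have hσ := hM.nonneg hS σ
  have hk : ∀ d m : ℕ, E _ _ ((ρ.pow (m + d)).tensor (σ.pow m)) ≤ a * m + b + E _ _ ρ * d := by
    intro d m
    induction d with
    | zero => simpa [hM.tensor_pow] using h m
    | succ d ih =>
      have := hM.pow_tensor_pow_add_le hS ρ σ (m + d) m 1 0
      rw [hM.tensor_pow_zero, hM.pow_one] at this
      refine le_trans this ?_
      push_cast
      linarith
  have hl : ∀ d m : ℕ, E _ _ ((ρ.pow m).tensor (σ.pow (m + d))) ≤ a * m + b + E _ _ σ * d := by
    intro d m
    induction d with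
    | zero => simpa [hM.tensor_pow] using h m
    | succ d ih =>
      have := hM.pow_tensor_pow_add_le hS ρ σ m (m + d) 0 1
      rw [hM.pow_zero_tensor, hM.pow_one] at this
      refine le_trans this ?_
      push_cast
      linarith
  rcases le_total l k with hlk | hlk
  · obtain ⟨d, rfl⟩ := Nat.exists_eq_add_of_le hlk
    have := hk d l
    have hd : (0 : ℝ) ≤ d := d.cast_nonneg
    push_cast
    rw [show (l : ℝ) + d - l = d by ring, abs_of_nonneg hd]
    nlinarith [mul_nonneg ha hd, mul_nonneg hσ hd]
  · obtain ⟨d, rfl⟩ := Nat.exists_eq_add_of_le hlk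
    have := hl d k
    have hd : (0 : ℝ) ≤ d := d.cast_nonneg
    push_cast
    rw [show (k : ℝ) - (k + d) = -d by ring, abs_neg, abs_of_nonneg hd]
    nlinarith [mul_nonneg ha hd, mul_nonneg hρ hd]

theorem exists_linear_bound_of_tendsto {f : ℕ → ℝ} {L a : ℝ}
    (hf : Tendsto (fun n : ℕ => f n / n) atTop (𝓝 L)) (ha : L < a) :
    ∃ b, ∀ n, f n ≤ a * n + b := by
  obtain ⟨N, hN⟩ := eventually_atTop.1 ((hf.eventually_lt_const ha).and (eventually_gt_atTop 0))
  obtain ⟨b, hb⟩ := ((Finset.range N).image fun n => f n - a * n).bddAbove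
  refine ⟨max b 0, fun n => ?_⟩
  rcases lt_or_ge n N with h | h
  · have := hb (Finset.mem_coe.2 (Finset.mem_image_of_mem _ (Finset.mem_range.2 h)))
    linarith [le_max_left b 0]
  · obtain ⟨h1, h2⟩ := hN n h
    rw [div_lt_iff₀ (by exact_mod_cast h2)] at h1
    linarith [le_max_right b 0]

/-- In the mixture of `ρ` and `σ`, half of the copies are copies of `ρ` and half of them copies of
`σ`, up to fluctuations of the order of the square root of their number. -/
theorem regularization_mix_le (hC : IsConvex E) (hS : IsSubadditive E) (hM : IsFullyMonotone E)
    (ρ : State (A × B)) (σ : State (C × D)) :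
    regularization E _ _ (ρ.mix σ) ≤ regularization E _ _ (ρ.tensor σ) / 2 := by
  set L := regularization E _ _ (ρ.tensor σ) with hL
  have hL0 : 0 ≤ L := hM.regularization_nonneg hS _
  refine le_of_forall_pos_le_add fun ε hε => ?_
  obtain ⟨b, hb⟩ := exists_linear_bound_of_tendsto
    (hM.tendsto_regularization hS (ρ.tensor σ)) (lt_add_of_pos_right L hε)
  set G := E _ _ ρ + E _ _ σ with hG
  have hbound := hM.pow_tensor_pow_le hS ρ σ (by positivity) hb
  have hn : ∀ n : ℕ, 0 < n → E _ _ ((ρ.mix σ).pow n) / n ≤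
      (L + ε) / 2 + ε / 2 + (b + G ^ 2 / (2 * ε)) / n := by
    intro n hn
    have hn' : (0 : ℝ) < n := by exact_mod_cast hn
    have hquad : ∀ k l : ℕ, E _ _ ((ρ.pow k).tensor (σ.pow l)) ≤
        (L + ε) / 2 * (k + l) + (b + ε / 2 * n) + G ^ 2 / (2 * ε * n) * ((k : ℝ) - l) ^ 2 := by
      intro k l
      refine (hbound k l).trans ?_
      -- the arithmetic-geometric mean inequality, with weights that balance at distance `√n`
      have : G * |(k : ℝ) - l| ≤ ε / 2 * n + G ^ 2 / (2 * ε * n) * ((k : ℝ) - l) ^ 2 := by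
        rw [← sq_abs ((k : ℝ) - l), ← sub_nonneg]
        have : ε / 2 * n + G ^ 2 / (2 * ε * n) * |(k : ℝ) - l| ^ 2 - G * |(k : ℝ) - l| =
            (ε * n - G * |(k : ℝ) - l|) ^ 2 / (2 * ε * n) := by
          field_simp
          ring
        rw [this]
        positivity
      linarith
    have h0 := mix_pow_tensor_le hC hM ρ σ hquad n 0 0
    have e : E _ _ (((ρ.mix σ).pow n).tensor ((ρ.pow 0).tensor (σ.pow 0))) =
        E _ _ ((ρ.mix σ).pow n) := by
      rw [← hM.tensor_assoc, hM.tensor_pow_zero, hM.tensor_pow_zero]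
    rw [e] at h0
    rw [div_le_iff₀ hn']
    refine h0.trans (le_of_eq ?_)
    push_cast
    field_simp
    ring
  have hlim : Tendsto (fun n : ℕ => (L + ε) / 2 + ε / 2 + (b + G ^ 2 / (2 * ε)) / n) atTop
      (𝓝 ((L + ε) / 2 + ε / 2 + 0)) :=
    tendsto_const_nhds.add (tendsto_const_div_atTop_nhds_zero_nat _)
  have := le_of_tendsto_of_tendsto (hM.tendsto_regularization hS (ρ.mix σ)) hlim
    (by filter_upwards [eventually_gt_atTop 0] with n h using hn n h)
  linarith

theorem IsFullyAdditive.regularization_of_monotone (hC : IsConvex E) (hS : IsSubadditive E)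
    (hM : IsFullyMonotone E) (hR : IsFullyMonotone (regularization E)) :
    IsFullyAdditive (regularization E) := by
  intro A B C D _ _ _ _ ρ σ
  refine le_antisymm (hM.regularization_tensor_le hS ρ σ) ?_
  linarith [hR.half_add_half_le_mix ρ σ, regularization_mix_le hC hS hM ρ σ]

theorem IsFullyMonotone.regularization_iff_additive (hC : IsConvex E) (hS : IsSubadditive E)
    (hM : IsFullyMonotone E) :
    IsFullyMonotone (regularization E) ↔ IsFullyAdditive (regularization E) :=
  ⟨IsFullyAdditive.regularization_of_monotone hC hS hM, hM.regularization_of_additive hS⟩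

end Regularization

/-! ### Spectral form of the relative entropy -/

section Spectral

/-- `M = U diag(r) Uᴴ` with `U` unitary and `r` real. -/
structure Diagonalizes {X : Type} [Fintype X] [DecidableEq X] (U : Matrix X X ℂ) (r : X → ℝ)
    (M : Matrix X X ℂ) : Prop where
  star_mul : Uᴴ * U = 1
  mul_star : U * Uᴴ = 1
  eq : M = U * diagonal (fun i => (r i : ℂ)) * Uᴴ

variable {X : Type} [Fintype X] [DecidableEq X]

theorem exists_diagonalizes {M : Matrix X X ℂ} (hM : M.PosSemidef) :
    ∃ U r, Diagonalizes U r M ∧ ∀ i, 0 ≤ r i := by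
  refine ⟨hM.1.eigenvectorUnitary, hM.1.eigenvalues, ⟨?_, ?_, ?_⟩, hM.eigenvalues_nonneg⟩
  · exact Unitary.coe_star_mul_self hM.1.eigenvectorUnitary
  · exact Unitary.coe_mul_star_self hM.1.eigenvectorUnitary
  · conv_lhs => rw [hM.1.spectral_theorem]
    rfl

namespace Diagonalizes

variable {U V : Matrix X X ℂ} {r s : X → ℝ} {M N : Matrix X X ℂ}

/-- The overlap matrix of two eigenbases intertwines the two diagonal forms of a matrix, and hence
all functions of them: the functional calculus may be evaluated in any eigenbasis. -/
theorem cfc_eq (h : Diagonalizes U r M) (f : ℝ → ℝ) :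
    cfc f M = U * diagonal (fun i => (f (r i) : ℂ)) * Uᴴ := by
  have hM : M.IsHermitian := by
    rw [h.eq]
    refine isHermitian_mul_mul_conjTranspose _ ?_
    rw [IsHermitian, diagonal_conjTranspose]
    congr 1
    ext i
    simp
  rw [hM.cfc_eq]
  set V : Matrix X X ℂ := (hM.eigenvectorUnitary : Matrix X X ℂ)
  set s := hM.eigenvalues
  have hV : Vᴴ * V = 1 := Unitary.coe_star_mul_self hM.eigenvectorUnitary
  have hV' : V * Vᴴ = 1 := Unitary.coe_mul_star_self hM.eigenvectorUnitary
  have hs : M = V * diagonal (fun i => (s i : ℂ)) * Vᴴ := hM.spectral_theorem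
  have hf : hM.cfc f = V * diagonal (fun i => (f (s i) : ℂ)) * Vᴴ := rfl
  rw [hf]
  have h1 : diagonal (fun i => (r i : ℂ)) * (Uᴴ * V) = (Uᴴ * V) * diagonal (fun i => (s i : ℂ)) := by
    have e1 : Uᴴ * M * V = diagonal (fun i => (r i : ℂ)) * (Uᴴ * V) := by
      rw [h.eq]
      simp only [← Matrix.mul_assoc, h.star_mul, Matrix.one_mul]
    have e2 : Uᴴ * M * V = (Uᴴ * V) * diagonal (fun i => (s i : ℂ)) := by
      rw [hs]
      simp only [Matrix.mul_assoc, hV, Matrix.mul_one]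
    rw [← e1, e2]
  have h2 : diagonal (fun i => (f (r i) : ℂ)) * (Uᴴ * V) =
      (Uᴴ * V) * diagonal (fun i => (f (s i) : ℂ)) := by
    ext i j
    have := congrFun (congrFun h1 i) j
    rw [diagonal_mul, mul_diagonal] at this ⊢
    rw [mul_comm, mul_eq_mul_left_iff] at this
    rcases this with h | h
    · rw [Complex.ofReal_injective h, mul_comm]
    · rw [h]; ring
  calc V * diagonal (fun i => (f (s i) : ℂ)) * Vᴴ
      = U * (Uᴴ * V * diagonal (fun i => (f (s i) : ℂ))) * Vᴴ := by
        simp only [← Matrix.mul_assoc, h.mul_star, Matrix.one_mul]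
    _ = U * diagonal (fun i => (f (r i) : ℂ)) * Uᴴ := by
        rw [← h2]
        simp only [Matrix.mul_assoc, hV', Matrix.mul_one]

theorem trace_eq (h : Diagonalizes U r M) : M.trace = ((∑ i, r i : ℝ) : ℂ) := by
  rw [h.eq, Matrix.mul_assoc, Matrix.trace_mul_comm, Matrix.mul_assoc, h.star_mul, Matrix.mul_one,
    trace_diagonal]
  push_cast
  rfl

/-- Squared moduli of the overlaps of two eigenbases form a doubly stochastic matrix. -/
theorem sum_norm_sq_right (h : Diagonalizes U r M) (h' : Diagonalizes V s N) (i : X) :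
    ∑ j, ‖(Uᴴ * V) i j‖ ^ 2 = 1 := by
  have : (Uᴴ * V) * (Uᴴ * V)ᴴ = 1 := by
    rw [conjTranspose_mul, conjTranspose_conjTranspose, Matrix.mul_assoc, ← Matrix.mul_assoc V,
      h'.mul_star, Matrix.one_mul, h.star_mul]
  have := congrFun (congrFun this i) i
  rw [Matrix.mul_apply, one_apply_eq] at this
  simp only [conjTranspose_apply, RCLike.star_def, Complex.mul_conj'] at this
  exact_mod_cast this

theorem sum_norm_sq_left (h : Diagonalizes U r M) (h' : Diagonalizes V s N) (j : X) :
    ∑ i, ‖(Uᴴ * V) i j‖ ^ 2 = 1 := by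
  have : (Uᴴ * V)ᴴ * (Uᴴ * V) = 1 := by
    rw [conjTranspose_mul, conjTranspose_conjTranspose, Matrix.mul_assoc, ← Matrix.mul_assoc U,
      h.mul_star, Matrix.one_mul, h'.star_mul]
  have := congrFun (congrFun this j) j
  rw [Matrix.mul_apply, one_apply_eq] at this
  simp only [conjTranspose_apply, RCLike.star_def, Complex.conj_mul'] at this
  exact_mod_cast this

theorem trace_mul_eq (h : Diagonalizes U r M) (h' : Diagonalizes V s N) :
    (M * N).trace = ((∑ i, ∑ j, ‖(Uᴴ * V) i j‖ ^ 2 * (r i * s j) : ℝ) : ℂ) := by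
  have e : (M * N).trace = (diagonal (fun i => (r i : ℂ)) * (Uᴴ * V) *
      (diagonal (fun i => (s i : ℂ)) * (Uᴴ * V)ᴴ)).trace := by
    rw [h.eq, h'.eq, conjTranspose_mul, conjTranspose_conjTranspose, Matrix.mul_assoc,
      Matrix.mul_assoc, Matrix.trace_mul_comm]
    simp only [Matrix.mul_assoc]
  rw [e, Matrix.trace]
  push_cast
  refine Finset.sum_congr rfl fun i _ => ?_
  rw [diag_apply, Matrix.mul_apply]
  refine Finset.sum_congr rfl fun j _ => ?_
  rw [diagonal_mul, diagonal_mul, conjTranspose_apply, RCLike.star_def]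
  have := Complex.mul_conj' ((Uᴴ * V) i j)
  linear_combination (r i : ℂ) * s j * this

end Diagonalizes

/-- `ker N ⊆ ker M`, the condition for `S(M‖N)` to be finite. -/
def KerLE (N M : Matrix X X ℂ) : Prop := ∀ v : X → ℂ, N.mulVec v = 0 → M.mulVec v = 0

open Classical in
/-- The relative entropy of positive semidefinite matrices of arbitrary trace, with the natural
logarithm. It is the correct value only if `KerLE N M`. -/
noncomputable def relEnt {X : Type} [Fintype X] (M N : Matrix X X ℂ) : ℝ :=
  (M * (cfc Real.log M - cfc Real.log N)).trace.re

namespace Diagonalizes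

variable {U V : Matrix X X ℂ} {r s : X → ℝ} {M N : Matrix X X ℂ}

theorem relEnt_eq (h : Diagonalizes U r M) (h' : Diagonalizes V s N) :
    relEnt M N =
      ∑ i, ∑ j, ‖(Uᴴ * V) i j‖ ^ 2 * (r i * (Real.log (r i) - Real.log (s j))) := by
  have hN : Diagonalizes V (fun j => Real.log (s j)) (cfc Real.log N) :=
    ⟨h'.star_mul, h'.mul_star, h'.cfc_eq _⟩
  have hM : Diagonalizes U (fun j => Real.log (r j)) (cfc Real.log M) :=
    ⟨h.star_mul, h.mul_star, h.cfc_eq _⟩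
  have e1 : (M * cfc Real.log M).trace = ((∑ i, r i * Real.log (r i) : ℝ) : ℂ) := by
    rw [h.trace_mul_eq hM, h.star_mul]
    congr 1
    refine Finset.sum_congr rfl fun i _ => ?_
    rw [Finset.sum_eq_single i]
    · simp
    · intro j _ hj
      simp [hj.symm]
    · simp
  have e0 : relEnt M N = (M * (cfc Real.log M - cfc Real.log N)).trace.re := by
    unfold relEnt
    congr!
  rw [e0, Matrix.mul_sub, Matrix.trace_sub, e1, h.trace_mul_eq hN, ← Complex.ofReal_sub,
    Complex.ofReal_re]
  have : ∑ i, r i * Real.log (r i) =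
      ∑ i, ∑ j, ‖(Uᴴ * V) i j‖ ^ 2 * (r i * Real.log (r i)) := by
    refine Finset.sum_congr rfl fun i _ => ?_
    rw [← Finset.sum_mul, h.sum_norm_sq_right h', one_mul]
  rw [this, ← Finset.sum_sub_distrib]
  refine Finset.sum_congr rfl fun i _ => ?_
  rw [← Finset.sum_sub_distrib]
  refine Finset.sum_congr rfl fun j _ => ?_
  ring

theorem mul_overlap (h : Diagonalizes U r M) (i j : X) :
    (Uᴴ *ᵥ (M *ᵥ fun k => V k j)) i = r i * (Uᴴ * V) i j := by
  have : (Uᴴ * M * V) i j = r i * (Uᴴ * V) i j := by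
    rw [h.eq]
    simp only [← Matrix.mul_assoc, h.star_mul, Matrix.one_mul]
    rw [Matrix.mul_assoc, diagonal_mul]
  rw [← this, Matrix.mulVec_mulVec, Matrix.mul_apply]
  rfl

theorem kerLE_iff (h : Diagonalizes U r M) (h' : Diagonalizes V s N) :
    KerLE N M ↔ ∀ i j, s j = 0 → r i ≠ 0 → (Uᴴ * V) i j = 0 := by
  constructor
  · intro hk i j hs hr
    have : N *ᵥ (fun k => V k j) = 0 := by
      have e : Vᴴ *ᵥ (N *ᵥ fun k => V k j) = 0 := by
        ext i
        rw [h'.mul_overlap, h'.star_mul, Matrix.one_apply]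
        split_ifs with hij
        · simp [hij, hs]
        · simp
      have := congrArg (fun v => V *ᵥ v) e
      simpa [Matrix.mulVec_mulVec, ← Matrix.mul_assoc, h'.mul_star] using this
    have e := h.mul_overlap (V := V) i j
    rw [hk _ this, Matrix.mulVec_zero, Pi.zero_apply] at e
    exact (mul_eq_zero.1 e.symm).resolve_left (by exact_mod_cast hr)
  · intro hk v hv
    have hw : ∀ j, s j ≠ 0 → (Vᴴ *ᵥ v) j = 0 := by
      intro j hj
      have : (Vᴴ *ᵥ (N *ᵥ v)) j = s j * (Vᴴ *ᵥ v) j := by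
        rw [h'.eq, Matrix.mulVec_mulVec]
        simp only [← Matrix.mul_assoc, h'.star_mul, Matrix.one_mul]
        rw [← Matrix.mulVec_mulVec, Matrix.mulVec_diagonal]
      rw [hv, Matrix.mulVec_zero, Pi.zero_apply] at this
      exact (mul_eq_zero.1 this.symm).resolve_left (by exact_mod_cast hj)
    have e : M *ᵥ v = U *ᵥ (diagonal (fun i => (r i : ℂ)) *ᵥ ((Uᴴ * V) *ᵥ (Vᴴ *ᵥ v))) := by
      rw [h.eq]
      simp only [Matrix.mulVec_mulVec, Matrix.mul_assoc]
      rw [h'.mul_star, Matrix.mul_one]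
    rw [e]
    have : diagonal (fun i => (r i : ℂ)) *ᵥ ((Uᴴ * V) *ᵥ (Vᴴ *ᵥ v)) = 0 := by
      ext i
      rw [Matrix.mulVec_diagonal, Pi.zero_apply, mul_eq_zero]
      by_cases hr : r i = 0
      · left; exact_mod_cast hr
      · right
        refine Finset.sum_eq_zero fun j _ => ?_
        dsimp only
        by_cases hs : s j = 0
        · rw [hk i j hs hr, zero_mul]
        · rw [hw j hs, mul_zero]
    rw [this, Matrix.mulVec_zero]

end Diagonalizes

end Spectral

section Kernels

variable {X Y : Type} [Fintype X] [Fintype Y]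

theorem mulVec_eq_zero_of_sum {Z : Type} [Fintype Z] {N : Z → Matrix X X ℂ}
    (hN : ∀ z, (N z).PosSemidef) {v : X → ℂ} (hv : (∑ z, N z) *ᵥ v = 0) (z : Z) :
    N z *ᵥ v = 0 := by
  classical
  have h0 : ∑ z, star v ⬝ᵥ (N z *ᵥ v) = 0 := by
    rw [← dotProduct_sum, ← Matrix.sum_mulVec, hv, dotProduct_zero]
  exact ((hN z).dotProduct_mulVec_zero_iff v).1
    ((Finset.sum_eq_zero_iff_of_nonneg fun z _ => (hN z).dotProduct_mulVec_nonneg v).1 h0 z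
      (Finset.mem_univ z))

theorem KerLE.sum {Z : Type} [Fintype Z] {M N : Z → Matrix X X ℂ}
    (hN : ∀ z, (N z).PosSemidef) (h : ∀ z, KerLE (N z) (M z)) : KerLE (∑ z, N z) (∑ z, M z) := by
  intro v hv
  rw [Matrix.sum_mulVec]
  exact Finset.sum_eq_zero fun z _ => h z v (mulVec_eq_zero_of_sum hN hv z)

theorem KerLE.conj {M N : Matrix X X ℂ} (hN : N.PosSemidef) (h : KerLE N M) (K : Matrix Y X ℂ) :
    KerLE (K * N * Kᴴ) (K * M * Kᴴ) := by
  classical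
  intro v hv
  have h0 : star (Kᴴ *ᵥ v) ⬝ᵥ (N *ᵥ (Kᴴ *ᵥ v)) = 0 := by
    have : star v ⬝ᵥ ((K * N * Kᴴ) *ᵥ v) = 0 := by rw [hv, dotProduct_zero]
    rw [← this, star_mulVec, conjTranspose_conjTranspose, ← dotProduct_mulVec]
    simp only [Matrix.mulVec_mulVec, Matrix.mul_assoc]
  have := h _ ((hN.dotProduct_mulVec_zero_iff _).1 h0)
  rw [← Matrix.mulVec_mulVec, ← Matrix.mulVec_mulVec, this, Matrix.mulVec_zero]

end Kernels

/-! ### Joint convexity and monotonicity of the relative entropy -/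

section Variational

variable {X : Type} [Fintype X]

/-- The quadratic functional whose maximum over `Z`, for `t > 0`, is
`∑ i j, |⟨eᵢ, fⱼ⟩|² rᵢ² / (sⱼ + t rᵢ)`, where `rᵢ, eᵢ` and `sⱼ, fⱼ` are the spectral data of `M` and of `N`. -/
noncomputable def quad (t : ℝ) (M N Z : Matrix X X ℂ) : ℝ :=
  2 * (Zᴴ * M).trace.re - (Zᴴ * N * Z).trace.re - t * (Z * M * Zᴴ).trace.re

variable [DecidableEq X] {U V : Matrix X X ℂ} {r s : X → ℝ} {M N : Matrix X X ℂ}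

theorem Diagonalizes.quad_eq (h : Diagonalizes U r M) (h' : Diagonalizes V s N) (t : ℝ)
    (Z : Matrix X X ℂ) :
    quad t M N (V * Z * Uᴴ) = ∑ i, ∑ j,
      (2 * r i * (star (Z j i) * star ((Uᴴ * V) i j)).re - (s j + t * r i) * ‖Z j i‖ ^ 2) := by
  have hc : (V * Z * Uᴴ)ᴴ = U * Zᴴ * Vᴴ := by
    simp only [conjTranspose_mul, conjTranspose_conjTranspose, Matrix.mul_assoc]
  have hW : Vᴴ * U = (Uᴴ * V)ᴴ := by
    rw [conjTranspose_mul, conjTranspose_conjTranspose]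
  have h1 : ((V * Z * Uᴴ)ᴴ * M).trace =
      ∑ i, ∑ j, star (Z j i) * star ((Uᴴ * V) i j) * r i := by
    have : (V * Z * Uᴴ)ᴴ * M = U * (Zᴴ * ((Uᴴ * V)ᴴ * diagonal (fun i => (r i : ℂ))) * Uᴴ) := by
      rw [hc, h.eq, ← hW]
      simp only [Matrix.mul_assoc]
    rw [this, trace_mul_comm, Matrix.mul_assoc, h.star_mul, Matrix.mul_one, Matrix.trace]
    refine Finset.sum_congr rfl fun i _ => ?_
    rw [diag_apply, Matrix.mul_apply]
    refine Finset.sum_congr rfl fun j _ => ?_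
    rw [mul_diagonal, conjTranspose_apply, conjTranspose_apply, mul_assoc]
  have h2 : ((V * Z * Uᴴ)ᴴ * N * (V * Z * Uᴴ)).trace =
      ((∑ i, ∑ j, s j * ‖Z j i‖ ^ 2 : ℝ) : ℂ) := by
    have : (V * Z * Uᴴ)ᴴ * N * (V * Z * Uᴴ) =
        U * (Zᴴ * (diagonal (fun i => (s i : ℂ)) * Z) * Uᴴ) := by
      have e : ∀ P Q : Matrix X X ℂ, P * Vᴴ * (V * Q) = P * Q := by
        intro P Q
        rw [Matrix.mul_assoc, ← Matrix.mul_assoc Vᴴ, h'.star_mul, Matrix.one_mul]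
      rw [hc, h'.eq, Matrix.mul_assoc V, e, Matrix.mul_assoc V, ← Matrix.mul_assoc _ _ Vᴴ, e]
      simp only [Matrix.mul_assoc]
    rw [this, trace_mul_comm, Matrix.mul_assoc, h.star_mul, Matrix.mul_one, Matrix.trace]
    push_cast
    refine Finset.sum_congr rfl fun i _ => ?_
    rw [diag_apply, Matrix.mul_apply]
    refine Finset.sum_congr rfl fun j _ => ?_
    rw [diagonal_mul, conjTranspose_apply, RCLike.star_def]
    linear_combination (s j : ℂ) * Complex.conj_mul' (Z j i)
  have h3 : ((V * Z * Uᴴ) * M * (V * Z * Uᴴ)ᴴ).trace =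
      ((∑ i, ∑ j, r i * ‖Z j i‖ ^ 2 : ℝ) : ℂ) := by
    have : (V * Z * Uᴴ) * M * (V * Z * Uᴴ)ᴴ =
        V * (Z * (diagonal (fun i => (r i : ℂ)) * Zᴴ) * Vᴴ) := by
      have e : ∀ P Q : Matrix X X ℂ, P * Uᴴ * (U * Q) = P * Q := by
        intro P Q
        rw [Matrix.mul_assoc, ← Matrix.mul_assoc Uᴴ, h.star_mul, Matrix.one_mul]
      rw [hc, h.eq, Matrix.mul_assoc U, e, Matrix.mul_assoc U, ← Matrix.mul_assoc _ _ Uᴴ, e]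
      simp only [Matrix.mul_assoc]
    rw [this, trace_mul_comm, Matrix.mul_assoc, h'.star_mul, Matrix.mul_one, Matrix.trace,
      Finset.sum_comm]
    push_cast
    refine Finset.sum_congr rfl fun j _ => ?_
    rw [diag_apply, Matrix.mul_apply]
    refine Finset.sum_congr rfl fun i _ => ?_
    rw [diagonal_mul, conjTranspose_apply, RCLike.star_def]
    linear_combination (r i : ℂ) * Complex.mul_conj' (Z j i)
  rw [quad, h1, h2, h3, Complex.ofReal_re, Complex.ofReal_re]
  simp only [Complex.re_sum, Complex.re_mul_ofReal, Finset.mul_sum, ← Finset.sum_sub_distrib]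
  refine Finset.sum_congr rfl fun i _ => Finset.sum_congr rfl fun j _ => ?_
  ring

theorem Diagonalizes.quad_le (h : Diagonalizes U r M) (h' : Diagonalizes V s N)
    (hr : ∀ i, 0 ≤ r i) (hs : ∀ i, 0 ≤ s i) {t : ℝ} (ht : 0 < t) (Z : Matrix X X ℂ) :
    quad t M N Z ≤ ∑ i, ∑ j, ‖(Uᴴ * V) i j‖ ^ 2 * (r i ^ 2 / (s j + t * r i)) := by
  have hZ : Z = V * (Vᴴ * Z * U) * Uᴴ := by
    simp only [Matrix.mul_assoc, h.mul_star, Matrix.mul_one]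
    rw [← Matrix.mul_assoc, h'.mul_star, Matrix.one_mul]
  rw [hZ, h.quad_eq h']
  refine Finset.sum_le_sum fun i _ => Finset.sum_le_sum fun j _ => ?_
  set z := (Vᴴ * Z * U) j i
  set w := (Uᴴ * V) i j
  have hre : (star z * star w).re ≤ ‖z‖ * ‖w‖ := by
    refine (Complex.re_le_norm _).trans (le_of_eq ?_)
    rw [norm_mul, norm_star, norm_star]
  rcases (hr i).eq_or_lt with hri | hri
  · rw [← hri]
    have := mul_nonneg (hs j) (sq_nonneg ‖z‖)
    simp only [mul_zero, zero_mul, add_zero, ne_eq, OfNat.ofNat_ne_zero, not_false_eq_true,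
      zero_pow, zero_div, zero_sub]
    linarith
  · have hq : 0 < s j + t * r i := add_pos_of_nonneg_of_pos (hs j) (mul_pos ht hri)
    rw [← mul_div_assoc, le_div_iff₀ hq]
    have h1 := mul_le_mul_of_nonneg_left hre (mul_pos (mul_pos two_pos hri) hq).le
    nlinarith [sq_nonneg ((s j + t * r i) * ‖z‖ - r i * ‖w‖)]

theorem Diagonalizes.exists_quad_eq (h : Diagonalizes U r M) (h' : Diagonalizes V s N) (t : ℝ) :
    ∃ Z, quad t M N Z = ∑ i, ∑ j, ‖(Uᴴ * V) i j‖ ^ 2 * (r i ^ 2 / (s j + t * r i)) := by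
  refine ⟨V * Matrix.of (fun j i => ((r i / (s j + t * r i) : ℝ) : ℂ) * star ((Uᴴ * V) i j)) * Uᴴ,
    ?_⟩
  rw [h.quad_eq h']
  refine Finset.sum_congr rfl fun i _ => Finset.sum_congr rfl fun j _ => ?_
  set w := (Uᴴ * V) i j
  have e : star (((r i / (s j + t * r i) : ℝ) : ℂ) * star w) * star w =
      ((r i / (s j + t * r i) * ‖w‖ ^ 2 : ℝ) : ℂ) := by
    rw [star_mul', star_star, RCLike.star_def, Complex.conj_ofReal, mul_assoc,
      Complex.mul_conj']
    push_cast
    rfl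
  rw [Matrix.of_apply, e, Complex.ofReal_re, norm_mul, norm_star, Complex.norm_real,
    Real.norm_eq_abs, mul_pow, sq_abs]
  by_cases hq : s j + t * r i = 0
  · simp [hq]
  · field_simp
    ring

end Variational

section Integral

open MeasureTheory

theorem intervalIntegral_term {c r s : ℝ} (hr : 0 ≤ r) (hs : 0 ≤ s)
    (hc : s = 0 → r ≠ 0 → c = 0) {T : ℝ} (hT : 0 < T) :
    IntervalIntegrable (fun t => c * (r ^ 2 / (s + t * r))) volume 0 T ∧
      ∫ t in (0 : ℝ)..T, c * (r ^ 2 / (s + t * r)) =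
        c * (r * (Real.log (s + T * r) - Real.log s)) := by
  by_cases hc0 : c = 0
  · simp [hc0]
  by_cases hr0 : r = 0
  · simp [hr0]
  have hs0 : 0 < s := lt_of_le_of_ne hs fun h => hc0 (hc h.symm hr0)
  have hpos : ∀ t ∈ Set.uIcc 0 T, 0 < s + t * r := by
    intro t ht
    rw [Set.uIcc_of_le hT.le] at ht
    exact add_pos_of_pos_of_nonneg hs0 (mul_nonneg ht.1 hr)
  have hint : IntervalIntegrable (fun t => c * (r ^ 2 / (s + t * r))) volume 0 T := by
    refine ContinuousOn.intervalIntegrable ?_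
    exact continuousOn_const.mul (continuousOn_const.div (by fun_prop) fun t ht => (hpos t ht).ne')
  refine ⟨hint, ?_⟩
  rw [intervalIntegral.integral_eq_sub_of_hasDerivAt
    (f := fun t => c * (r * Real.log (s + t * r))) ?_ hint]
  · rw [zero_mul, add_zero]
    ring
  · intro t ht
    have h1 : HasDerivAt (fun t : ℝ => s + t * r) r t := by
      simpa using ((hasDerivAt_id t).mul_const r).const_add s
    have := ((h1.log (hpos t ht).ne').const_mul r).const_mul c
    exact this.congr_deriv (by ring)

theorem tendsto_term (c : ℝ) {r s : ℝ} (hr : 0 ≤ r) :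
    Tendsto (fun T : ℝ => c * (r * (Real.log (s + T * r) - Real.log s)) - c * r * Real.log T) atTop
      (𝓝 (c * (r * (Real.log r - Real.log s)))) := by
  rcases hr.eq_or_lt with rfl | hr
  · simp
  have h1 : Tendsto (fun T : ℝ => Real.log (s / T + r)) atTop (𝓝 (Real.log r)) := by
    have : Tendsto (fun T : ℝ => s / T + r) atTop (𝓝 (0 + r)) :=
      (tendsto_const_nhds.div_atTop tendsto_id).add_const r
    rw [zero_add] at this
    exact this.log hr.ne'
  refine Tendsto.congr' ?_ (((h1.sub_const (Real.log s)).const_mul r).const_mul c)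
  have hlim : Tendsto (fun T : ℝ => s + T * r) atTop atTop :=
    tendsto_atTop_add_const_left _ _ (tendsto_id.atTop_mul_const hr)
  filter_upwards [eventually_gt_atTop 0, hlim.eventually_gt_atTop 0] with T hT hT'
  have : s / T + r = (s + T * r) / T := by field_simp
  rw [this, Real.log_div hT'.ne' hT.ne']
  ring

/-- The relative entropy is a limit of integrals of maxima of the functionals `quad t`, because
`r (log r - log s)` is the limit of `∫₀ᵀ r² / (s + t r) dt - r log T` as `T → ∞`. -/
theorem exists_integral_representation {X : Type} [Fintype X] {M N : Matrix X X ℂ}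
    (hM : M.PosSemidef) (hN : N.PosSemidef) (hk : KerLE N M) :
    ∃ g : ℝ → ℝ, (∀ t, 0 < t → (∀ Z, quad t M N Z ≤ g t) ∧ ∃ Z, quad t M N Z = g t) ∧
      (∀ T, 0 < T → IntervalIntegrable g volume 0 T) ∧
      Tendsto (fun T => (∫ t in (0 : ℝ)..T, g t) - M.trace.re * Real.log T) atTop
        (𝓝 (relEnt M N)) := by
  classical
  obtain ⟨U, r, h, hr⟩ := exists_diagonalizes hM
  obtain ⟨V, s, h', hs⟩ := exists_diagonalizes hN
  have hc : ∀ i j, s j = 0 → r i ≠ 0 → ‖(Uᴴ * V) i j‖ ^ 2 = 0 := by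
    intro i j h1 h2
    rw [(h.kerLE_iff h').1 hk i j h1 h2]
    simp
  have hi : ∀ T : ℝ, 0 < T → ∀ i j, _ := fun T hT i j =>
    intervalIntegral_term (hr i) (hs j) (hc i j) hT
  have hi' : ∀ T : ℝ, 0 < T → ∀ i, IntervalIntegrable
      (fun t => ∑ j, ‖(Uᴴ * V) i j‖ ^ 2 * (r i ^ 2 / (s j + t * r i))) volume 0 T := by
    intro T hT i
    simpa only [Finset.sum_fn] using IntervalIntegrable.sum Finset.univ
      (fun j _ => (hi T hT i j).1)
  refine ⟨fun t => ∑ i, ∑ j, ‖(Uᴴ * V) i j‖ ^ 2 * (r i ^ 2 / (s j + t * r i)),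
    fun t ht => ⟨h.quad_le h' hr hs ht, h.exists_quad_eq h' t⟩, fun T hT => ?_, ?_⟩
  · simpa only [Finset.sum_fn] using IntervalIntegrable.sum Finset.univ
      (fun i _ => hi' T hT i)
  · rw [h.relEnt_eq h']
    refine Tendsto.congr' ?_ (tendsto_finsetSum _ fun i _ => tendsto_finsetSum _ fun j _ =>
      tendsto_term (‖(Uᴴ * V) i j‖ ^ 2) (s := s j) (hr i))
    filter_upwards [eventually_gt_atTop 0] with T hT
    rw [intervalIntegral.integral_finsetSum fun i _ => hi' T hT i]
    have e1 : ∀ i, ∫ t in (0 : ℝ)..T, ∑ j, ‖(Uᴴ * V) i j‖ ^ 2 * (r i ^ 2 / (s j + t * r i)) =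
        ∑ j, ‖(Uᴴ * V) i j‖ ^ 2 * (r i * (Real.log (s j + T * r i) - Real.log (s j))) := by
      intro i
      rw [intervalIntegral.integral_finsetSum fun j _ => (hi T hT i j).1]
      exact Finset.sum_congr rfl fun j _ => (hi T hT i j).2
    have e2 : M.trace.re * Real.log T =
        ∑ i, ∑ j, ‖(Uᴴ * V) i j‖ ^ 2 * r i * Real.log T := by
      rw [h.trace_eq, Complex.ofReal_re, Finset.sum_mul]
      refine Finset.sum_congr rfl fun i _ => ?_
      rw [← Finset.sum_mul, ← Finset.sum_mul, h.sum_norm_sq_right h', one_mul]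
    rw [Finset.sum_congr rfl fun i _ => e1 i, e2]
    simp only [Finset.sum_sub_distrib]

/-- A comparison principle: an inequality between the maxima of the functionals `quad t`, for all
`t > 0`, entails the inequality of the relative entropies. -/
theorem sum_relEnt_le_of_quad {X X' K L : Type} [Fintype X] [Fintype X'] [Fintype K] [Fintype L]
    {M N : K → Matrix X X ℂ} {M' N' : L → Matrix X' X' ℂ}
    (hM : ∀ k, (M k).PosSemidef) (hN : ∀ k, (N k).PosSemidef) (hk : ∀ k, KerLE (N k) (M k))
    (hM' : ∀ l, (M' l).PosSemidef) (hN' : ∀ l, (N' l).PosSemidef)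
    (hk' : ∀ l, KerLE (N' l) (M' l)) (htr : ∑ l, (M' l).trace = ∑ k, (M k).trace)
    (hq : ∀ t, 0 < t → ∀ Z' : L → Matrix X' X' ℂ, ∃ Z : K → Matrix X X ℂ,
      ∑ l, quad t (M' l) (N' l) (Z' l) ≤ ∑ k, quad t (M k) (N k) (Z k)) :
    ∑ l, relEnt (M' l) (N' l) ≤ ∑ k, relEnt (M k) (N k) := by
  choose g hg hgi hgt using fun k => exists_integral_representation (hM k) (hN k) (hk k)
  choose g' hg' hgi' hgt' using fun l => exists_integral_representation (hM' l) (hN' l) (hk' l)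
  refine le_of_tendsto_of_tendsto (tendsto_finsetSum _ fun l _ => hgt' l)
    (tendsto_finsetSum _ fun k _ => hgt k) ?_
  filter_upwards [eventually_gt_atTop 0] with T hT
  rw [Finset.sum_sub_distrib, Finset.sum_sub_distrib, ← Finset.sum_mul, ← Finset.sum_mul,
    ← Complex.re_sum, ← Complex.re_sum, htr]
  refine sub_le_sub_right ?_ _
  rw [← intervalIntegral.integral_finsetSum fun l _ => hgi' l T hT,
    ← intervalIntegral.integral_finsetSum fun k _ => hgi k T hT]
  refine intervalIntegral.integral_mono_on_of_le_Ioo hT.le ?_ ?_ fun t ht => ?_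
  · simpa only [Finset.sum_fn] using IntervalIntegrable.sum Finset.univ (fun l _ => hgi' l T hT)
  · simpa only [Finset.sum_fn] using IntervalIntegrable.sum Finset.univ (fun k _ => hgi k T hT)
  · choose Z' hZ' using fun l => (hg' l t ht.1).2
    obtain ⟨Z, hZ⟩ := hq t ht.1 Z'
    simp only [← hZ']
    exact hZ.trans (Finset.sum_le_sum fun k _ => (hg k t ht.1).1 _)

end Integral

section Convexity

/-- The relative entropy is jointly subadditive; with homogeneity, this is joint convexity. -/
theorem relEnt_sum_le {X K : Type} [Fintype X] [Fintype K] {M N : K → Matrix X X ℂ}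
    (hM : ∀ k, (M k).PosSemidef) (hN : ∀ k, (N k).PosSemidef) (hk : ∀ k, KerLE (N k) (M k)) :
    relEnt (∑ k, M k) (∑ k, N k) ≤ ∑ k, relEnt (M k) (N k) := by
  have := sum_relEnt_le_of_quad (L := Unit) (M' := fun _ => ∑ k, M k) (N' := fun _ => ∑ k, N k)
    hM hN hk (fun _ => posSemidef_sum _ fun k _ => hM k) (fun _ => posSemidef_sum _ fun k _ => hN k)
    (fun _ => KerLE.sum hN hk) (by simp [Matrix.trace_sum]) ?_
  · simpa using this
  · intro t _ Z'
    refine ⟨fun _ => Z' (), le_of_eq ?_⟩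
    simp only [quad, Finset.univ_unique, Finset.sum_singleton, Matrix.sum_mul,
      Matrix.trace_sum, Complex.re_sum, Finset.sum_sub_distrib, Finset.mul_sum]

/-- The Kadison–Schwarz inequality `Φ*(Z)ᴴ Φ*(Z) ≤ Φ*(Zᴴ Z)`, for the unital map `Φ*` with Kraus
operators `K z` acting on block diagonal matrices, in the form tested against `N`. -/
theorem kadison_schwarz {X Y ζ : Type} [Fintype X] [DecidableEq X] [Fintype Y] [Fintype ζ]
    {K : ζ → Matrix Y X ℂ} (hK : ∑ z, (K z)ᴴ * K z = 1) (Z : ζ → Matrix Y Y ℂ)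
    {N : Matrix X X ℂ} (hN : N.PosSemidef) :
    ((∑ z, (K z)ᴴ * Z z * K z)ᴴ * N * (∑ z, (K z)ᴴ * Z z * K z)).trace.re ≤
      ∑ z, ((Z z)ᴴ * (K z * N * (K z)ᴴ) * Z z).trace.re := by
  set S := ∑ z, (K z)ᴴ * Z z * K z with hS
  have hSc : Sᴴ = ∑ z, (K z)ᴴ * (Z z)ᴴ * K z := by
    rw [hS, conjTranspose_sum]
    simp only [conjTranspose_mul, conjTranspose_conjTranspose, Matrix.mul_assoc]
  have h0 : ∀ z, 0 ≤ ((((K z)ᴴ * Z z - S * (K z)ᴴ)ᴴ * N * ((K z)ᴴ * Z z - S * (K z)ᴴ)).trace).re :=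
    fun z => (Complex.nonneg_iff.1 (hN.conjTranspose_mul_mul_same _).trace_nonneg).1
  have h1 : ∀ z, (((K z)ᴴ * Z z - S * (K z)ᴴ)ᴴ * N * ((K z)ᴴ * Z z - S * (K z)ᴴ)).trace =
      ((Z z)ᴴ * (K z * N * (K z)ᴴ) * Z z).trace - ((K z)ᴴ * (Z z)ᴴ * K z * (N * S)).trace
        - (Sᴴ * N * ((K z)ᴴ * Z z * K z)).trace + (Sᴴ * N * S * ((K z)ᴴ * K z)).trace := by
    intro z
    have e1 : ((K z)ᴴ * (Z z)ᴴ * K z * (N * S)).trace = ((Z z)ᴴ * K z * N * (S * (K z)ᴴ)).trace := by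
      rw [Matrix.mul_assoc, Matrix.mul_assoc, trace_mul_comm]
      simp only [Matrix.mul_assoc]
    have e2 : (Sᴴ * N * ((K z)ᴴ * Z z * K z)).trace = (K z * Sᴴ * N * ((K z)ᴴ * Z z)).trace := by
      rw [← Matrix.mul_assoc, trace_mul_comm]
      simp only [Matrix.mul_assoc]
    have e3 : (Sᴴ * N * S * ((K z)ᴴ * K z)).trace = (K z * Sᴴ * N * (S * (K z)ᴴ)).trace := by
      rw [← Matrix.mul_assoc, trace_mul_comm]
      simp only [Matrix.mul_assoc]
    rw [e1, e2, e3, conjTranspose_sub, conjTranspose_mul, conjTranspose_mul,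
      conjTranspose_conjTranspose, Matrix.sub_mul, Matrix.sub_mul, Matrix.mul_sub, Matrix.mul_sub,
      trace_sub, trace_sub, trace_sub]
    simp only [Matrix.mul_assoc]
    ring
  have h2 : ∑ z, (((K z)ᴴ * Z z - S * (K z)ᴴ)ᴴ * N * ((K z)ᴴ * Z z - S * (K z)ᴴ)).trace =
      ∑ z, ((Z z)ᴴ * (K z * N * (K z)ᴴ) * Z z).trace - (Sᴴ * N * S).trace := by
    simp only [h1, Finset.sum_add_distrib, Finset.sum_sub_distrib]
    rw [← trace_sum, ← trace_sum, ← trace_sum, ← trace_sum, ← Matrix.sum_mul, ← Matrix.mul_sum,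
      ← Matrix.mul_sum, hK, ← hSc, ← hS, Matrix.mul_one]
    simp only [Matrix.mul_assoc, trace_sum]
    ring
  have h3 := Finset.sum_nonneg fun z (_ : z ∈ Finset.univ) => h0 z
  rw [← Complex.re_sum, h2, Complex.sub_re, Complex.re_sum] at h3
  linarith

/-- Monotonicity of the relative entropy under quantum instruments: the relative entropies of the
unnormalised outputs add up to at most the relative entropy of the input. -/
theorem sum_relEnt_instrument_le {X Y ζ I : Type} [Fintype X] [DecidableEq X] [Fintype Y]
    [Fintype ζ] [Fintype I] [DecidableEq I] {K : ζ → Matrix Y X ℂ}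
    (hK : ∑ z, (K z)ᴴ * K z = 1) (l : ζ → I) {M N : Matrix X X ℂ} (hM : M.PosSemidef)
    (hN : N.PosSemidef) (hk : KerLE N M) :
    ∑ i, relEnt (∑ z, if l z = i then K z * M * (K z)ᴴ else 0)
        (∑ z, if l z = i then K z * N * (K z)ᴴ else 0) ≤ relEnt M N := by
  have hpos : ∀ {P : Matrix X X ℂ}, P.PosSemidef → ∀ i z,
      (if l z = i then K z * P * (K z)ᴴ else 0).PosSemidef := by
    intro P hP i z
    split_ifs
    · exact hP.mul_mul_conjTranspose_same _
    · exact .zero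
  have hker : ∀ i z, KerLE (if l z = i then K z * N * (K z)ᴴ else 0)
      (if l z = i then K z * M * (K z)ᴴ else 0) := by
    intro i z
    split_ifs
    · exact hk.conj hN _
    · exact fun v hv => hv
  have hsel : ∀ F : ζ → I → ℂ, ∑ i, ∑ z, (if l z = i then F z i else 0) = ∑ z, F z (l z) := by
    intro F
    rw [Finset.sum_comm]
    exact Finset.sum_congr rfl fun z _ => by simp
  have htr0 : ∀ Q : ζ → Matrix Y Y ℂ, ∀ Z : I → Matrix Y Y ℂ, ∀ Z' : I → Matrix Y Y ℂ,
      ∑ i, (Z i * (∑ z, if l z = i then Q z else 0) * Z' i).trace =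
        ∑ z, (Z (l z) * Q z * Z' (l z)).trace := by
    intro Q Z Z'
    rw [← hsel fun z i => (Z i * Q z * Z' i).trace]
    refine Finset.sum_congr rfl fun i _ => ?_
    rw [Matrix.mul_sum, Matrix.sum_mul, trace_sum]
    refine Finset.sum_congr rfl fun z _ => ?_
    split_ifs <;> simp
  have := sum_relEnt_le_of_quad (K := Unit) (M := fun _ => M) (N := fun _ => N)
    (fun _ => hM) (fun _ => hN) (fun _ => hk)
    (fun i => posSemidef_sum _ fun z _ => hpos hM i z)
    (fun i => posSemidef_sum _ fun z _ => hpos hN i z)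
    (fun i => KerLE.sum (fun z => hpos hN i z) (hker i)) ?_ ?_
  · simpa using this
  · classical
    have := htr0 (fun z => K z * M * (K z)ᴴ) (fun _ => 1) (fun _ => 1)
    simp only [Matrix.one_mul, Matrix.mul_one] at this
    rw [this, Fintype.sum_unique (ι := Unit)]
    have e : ∀ z, (K z * M * (K z)ᴴ).trace = ((K z)ᴴ * K z * M).trace := by
      intro z
      rw [trace_mul_comm, Matrix.mul_assoc]
    rw [Finset.sum_congr rfl fun z _ => e z, ← trace_sum, ← Matrix.sum_mul, hK, Matrix.one_mul]
  · intro t ht Z'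
    refine ⟨fun _ => ∑ z, (K z)ᴴ * Z' (l z) * K z, ?_⟩
    rw [Fintype.sum_unique (ι := Unit)]
    have h1 := kadison_schwarz hK (fun z => Z' (l z)) hN
    have h2 := kadison_schwarz hK (fun z => (Z' (l z))ᴴ) hM
    have hSc : (∑ z, (K z)ᴴ * Z' (l z) * K z)ᴴ = ∑ z, (K z)ᴴ * (Z' (l z))ᴴ * K z := by
      rw [conjTranspose_sum]
      simp only [conjTranspose_mul, conjTranspose_conjTranspose, Matrix.mul_assoc]
    rw [← hSc] at h2
    simp only [conjTranspose_conjTranspose] at h2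
    have h3 : ((∑ z, (K z)ᴴ * Z' (l z) * K z)ᴴ * M).trace =
        ∑ z, ((Z' (l z))ᴴ * (K z * M * (K z)ᴴ)).trace := by
      rw [hSc, Matrix.sum_mul, trace_sum]
      refine Finset.sum_congr rfl fun z _ => ?_
      rw [Matrix.mul_assoc, Matrix.mul_assoc, trace_mul_comm]
      simp only [Matrix.mul_assoc]
    classical
    have g1 := htr0 (fun z => K z * M * (K z)ᴴ) (fun i => (Z' i)ᴴ) (fun _ => 1)
    simp only [Matrix.mul_one] at g1
    have g2 := htr0 (fun z => K z * N * (K z)ᴴ) (fun i => (Z' i)ᴴ) Z'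
    have g3 := htr0 (fun z => K z * M * (K z)ᴴ) Z' (fun i => (Z' i)ᴴ)
    simp only [quad]
    rw [Finset.sum_sub_distrib, Finset.sum_sub_distrib, ← Finset.mul_sum, ← Finset.mul_sum,
      ← Complex.re_sum, ← Complex.re_sum, ← Complex.re_sum, g1, g2, g3, h3, Complex.re_sum,
      Complex.re_sum, Complex.re_sum]
    have h2' := mul_le_mul_of_nonneg_left h2 ht.le
    linarith

end Convexity

/-! ### The relative entropy of entanglement -/

section RelEnt

variable {X : Type} [Fintype X]

theorem trace_eq_re {M : Matrix X X ℂ} (hM : M.PosSemidef) : M.trace = (M.trace.re : ℂ) :=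
  Complex.ext rfl (Complex.nonneg_iff.1 hM.trace_nonneg).2.symm

theorem trace_re_nonneg {M : Matrix X X ℂ} (hM : M.PosSemidef) : 0 ≤ M.trace.re :=
  (Complex.nonneg_iff.1 hM.trace_nonneg).1

theorem posSemidef_smul {X : Type} {M : Matrix X X ℂ} (hM : M.PosSemidef) {p : ℝ} (hp : 0 ≤ p) :
    ((p : ℂ) • M).PosSemidef :=
  hM.smul (Complex.zero_le_real.2 hp)

theorem sub_le_mul_log_sub_log {r s : ℝ} (hr : 0 < r) (hs : 0 < s) :
    r - s ≤ r * (Real.log r - Real.log s) := by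
  have h := Real.log_le_sub_one_of_pos (div_pos hs hr)
  rw [Real.log_div hs.ne' hr.ne'] at h
  have := mul_le_mul_of_nonneg_left h hr.le
  rw [mul_sub, mul_sub, mul_div_cancel₀ _ hr.ne', mul_one] at this
  linarith

/-- Klein's inequality. -/
theorem trace_sub_trace_le_relEnt {M N : Matrix X X ℂ} (hM : M.PosSemidef) (hN : N.PosSemidef)
    (hk : KerLE N M) : M.trace.re - N.trace.re ≤ relEnt M N := by
  classical
  obtain ⟨U, r, h, hr⟩ := exists_diagonalizes hM
  obtain ⟨V, s, h', hs⟩ := exists_diagonalizes hN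
  have e1 : M.trace.re = ∑ i, ∑ j, ‖(Uᴴ * V) i j‖ ^ 2 * r i := by
    rw [h.trace_eq, Complex.ofReal_re]
    refine Finset.sum_congr rfl fun i _ => ?_
    rw [← Finset.sum_mul, h.sum_norm_sq_right h', one_mul]
  have e2 : N.trace.re = ∑ i, ∑ j, ‖(Uᴴ * V) i j‖ ^ 2 * s j := by
    rw [h'.trace_eq, Complex.ofReal_re, Finset.sum_comm]
    refine Finset.sum_congr rfl fun i _ => ?_
    rw [← Finset.sum_mul, h.sum_norm_sq_left h', one_mul]
  rw [h.relEnt_eq h', e1, e2, ← Finset.sum_sub_distrib]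
  refine Finset.sum_le_sum fun i _ => ?_
  rw [← Finset.sum_sub_distrib]
  refine Finset.sum_le_sum fun j _ => ?_
  rw [← mul_sub]
  rcases (hr i).eq_or_lt with hri | hri
  · rw [← hri]
    nlinarith [mul_nonneg (sq_nonneg ‖(Uᴴ * V) i j‖) (hs j)]
  · rcases (hs j).eq_or_lt with hsj | hsj
    · rw [(h.kerLE_iff h').1 hk i j hsj.symm hri.ne']
      simp
    · exact mul_le_mul_of_nonneg_left (sub_le_mul_log_sub_log hri hsj) (sq_nonneg _)

theorem Diagonalizes.smul [DecidableEq X] {U M : Matrix X X ℂ} {r : X → ℝ}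
    (h : Diagonalizes U r M) (p : ℝ) : Diagonalizes U (fun i => p * r i) ((p : ℂ) • M) := by
  refine ⟨h.star_mul, h.mul_star, ?_⟩
  have : diagonal (fun i => ((p * r i : ℝ) : ℂ)) = (p : ℂ) • diagonal (fun i => (r i : ℂ)) := by
    rw [← diagonal_smul]
    congr 1
    ext i
    simp
  rw [this, Matrix.mul_smul, Matrix.smul_mul, ← h.eq]

theorem relEnt_smul {M N : Matrix X X ℂ} (hM : M.PosSemidef) (hN : N.PosSemidef)
    (hk : KerLE N M) {p q : ℝ} (hp : 0 < p) (hq : 0 < q) :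
    relEnt ((p : ℂ) • M) ((q : ℂ) • N) =
      p * (relEnt M N + M.trace.re * (Real.log p - Real.log q)) := by
  classical
  obtain ⟨U, r, h, hr⟩ := exists_diagonalizes hM
  obtain ⟨V, s, h', hs⟩ := exists_diagonalizes hN
  have e1 : M.trace.re * (Real.log p - Real.log q) =
      ∑ i, ∑ j, ‖(Uᴴ * V) i j‖ ^ 2 * r i * (Real.log p - Real.log q) := by
    rw [h.trace_eq, Complex.ofReal_re, Finset.sum_mul]
    refine Finset.sum_congr rfl fun i _ => ?_
    rw [← Finset.sum_mul, ← Finset.sum_mul, h.sum_norm_sq_right h', one_mul]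
  rw [(h.smul p).relEnt_eq (h'.smul q), h.relEnt_eq h', e1, ← Finset.sum_add_distrib,
    Finset.mul_sum]
  refine Finset.sum_congr rfl fun i _ => ?_
  rw [← Finset.sum_add_distrib, Finset.mul_sum]
  refine Finset.sum_congr rfl fun j _ => ?_
  by_cases hri : r i = 0
  · simp [hri]
  by_cases hsj : s j = 0
  · rw [(h.kerLE_iff h').1 hk i j hsj hri]
    simp
  rw [Real.log_mul hp.ne' hri, Real.log_mul hq.ne' hsj]
  ring

theorem relEnt_zero_left (N : Matrix X X ℂ) : relEnt 0 N = 0 := by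
  simp [relEnt]

theorem relEnt_smul_self {M N : Matrix X X ℂ} (hM : M.PosSemidef) (hN : N.PosSemidef)
    (hk : KerLE N M) {p : ℝ} (hp : 0 ≤ p) :
    relEnt ((p : ℂ) • M) ((p : ℂ) • N) = p * relEnt M N := by
  rcases hp.eq_or_lt with rfl | hp
  · simp [relEnt_zero_left]
  · rw [relEnt_smul hM hN hk hp hp]
    simp

theorem KerLE.smul {M N : Matrix X X ℂ} (hk : KerLE N M) (p : ℂ) : KerLE (p • N) (p • M) := by
  intro v hv
  rw [smul_mulVec, smul_eq_zero] at hv ⊢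
  exact hv.imp_right (hk v)

theorem kerLE_of_smul {M N : Matrix X X ℂ} {p q : ℂ} (hp : p ≠ 0) (hk : KerLE (q • N) (p • M)) :
    KerLE N M := by
  intro v hv
  have := hk v (by rw [smul_mulVec, hv, smul_zero])
  rw [smul_mulVec, smul_eq_zero] at this
  exact this.resolve_left hp

end RelEnt

section Tensor

variable {A₁ B₁ A₂ B₂ : Type} [Fintype A₁] [Fintype B₁] [Fintype A₂] [Fintype B₂]

theorem tensorMat_one {A₁ B₁ A₂ B₂ : Type} [DecidableEq A₁] [DecidableEq B₁] [DecidableEq A₂] [DecidableEq B₂] :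
    tensorMat (1 : Matrix (A₁ × B₁) (A₁ × B₁) ℂ) (1 : Matrix (A₂ × B₂) (A₂ × B₂) ℂ) = 1 := by
  rw [← one_kronecker_one, ← one_kronecker_one, tensorMat_kronecker, one_kronecker_one,
    one_kronecker_one, one_kronecker_one]

theorem Diagonalizes.tensor [DecidableEq A₁] [DecidableEq B₁] [DecidableEq A₂] [DecidableEq B₂]
    {U M : Matrix (A₁ × B₁) (A₁ × B₁) ℂ} {U' M' : Matrix (A₂ × B₂) (A₂ × B₂) ℂ}
    {r : A₁ × B₁ → ℝ} {r' : A₂ × B₂ → ℝ} (h : Diagonalizes U r M) (h' : Diagonalizes U' r' M') :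
    Diagonalizes (tensorMat U U')
      (fun x : (A₁ × A₂) × (B₁ × B₂) => r (x.1.1, x.2.1) * r' (x.1.2, x.2.2)) (tensorMat M M') := by
  refine ⟨?_, ?_, ?_⟩
  · rw [tensorMat_conjTranspose, tensorMat_mul, h.star_mul, h'.star_mul, tensorMat_one]
  · rw [tensorMat_conjTranspose, tensorMat_mul, h.mul_star, h'.mul_star, tensorMat_one]
  · have : diagonal (fun x : (A₁ × A₂) × (B₁ × B₂) =>
        ((r (x.1.1, x.2.1) * r' (x.1.2, x.2.2) : ℝ) : ℂ)) =
        tensorMat (diagonal fun i => (r i : ℂ)) (diagonal fun i => (r' i : ℂ)) := by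
      rw [tensorMat, diagonal_kronecker_diagonal, submatrix_diagonal_equiv]
      congr 1
      ext x
      simp
    rw [this, tensorMat_conjTranspose, tensorMat_mul, tensorMat_mul, ← h.eq, ← h'.eq]

theorem sum_tensor (F : A₁ × B₁ → A₂ × B₂ → ℝ) :
    ∑ x : (A₁ × A₂) × (B₁ × B₂), F (x.1.1, x.2.1) (x.1.2, x.2.2) = ∑ a, ∑ b, F a b := by
  rw [← Fintype.sum_prod_type']
  exact Equiv.sum_comp (Equiv.prodProdProdComm A₁ A₂ B₁ B₂) fun y => F y.1 y.2

theorem sum_sum_mul {X Y : Type} [Fintype X] [Fintype Y] (S : X → X → ℝ) (T : Y → Y → ℝ) :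
    ∑ a, ∑ b, ∑ a', ∑ b', S a a' * T b b' = (∑ a, ∑ a', S a a') * ∑ b, ∑ b', T b b' := by
  rw [Finset.sum_mul]
  refine Finset.sum_congr rfl fun a _ => ?_
  rw [Finset.sum_mul, Finset.sum_comm]
  refine Finset.sum_congr rfl fun a' _ => ?_
  rw [Finset.mul_sum]
  exact Finset.sum_congr rfl fun b _ => (Finset.mul_sum _ _ _).symm

variable {M N : Matrix (A₁ × B₁) (A₁ × B₁) ℂ} {M' N' : Matrix (A₂ × B₂) (A₂ × B₂) ℂ}

theorem KerLE.tensor (hM : M.PosSemidef) (hN : N.PosSemidef)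
    (hM' : M'.PosSemidef) (hN' : N'.PosSemidef) (hk : KerLE N M) (hk' : KerLE N' M') :
    KerLE (tensorMat N N') (tensorMat M M') := by
  classical
  obtain ⟨U, r, h, hr⟩ := exists_diagonalizes hM
  obtain ⟨V, s, g, hs⟩ := exists_diagonalizes hN
  obtain ⟨U', r', h', hr'⟩ := exists_diagonalizes hM'
  obtain ⟨V', s', g', hs'⟩ := exists_diagonalizes hN'
  rw [(h.tensor h').kerLE_iff (g.tensor g')]
  intro i j hsj hri
  rw [tensorMat_conjTranspose, tensorMat_mul, tensorMat_apply, mul_eq_zero]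
  rcases mul_eq_zero.1 hsj with hj | hj
  · exact Or.inl ((h.kerLE_iff g).1 hk _ _ hj (left_ne_zero_of_mul hri))
  · exact Or.inr ((h'.kerLE_iff g').1 hk' _ _ hj (right_ne_zero_of_mul hri))

theorem relEnt_tensor (hM : M.PosSemidef) (hN : N.PosSemidef)
    (hM' : M'.PosSemidef) (hN' : N'.PosSemidef) (hk : KerLE N M) (hk' : KerLE N' M') :
    relEnt (tensorMat M M') (tensorMat N N') =
      relEnt M N * M'.trace.re + M.trace.re * relEnt M' N' := by
  classical
  obtain ⟨U, r, h, hr⟩ := exists_diagonalizes hM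
  obtain ⟨V, s, g, hs⟩ := exists_diagonalizes hN
  obtain ⟨U', r', h', hr'⟩ := exists_diagonalizes hM'
  obtain ⟨V', s', g', hs'⟩ := exists_diagonalizes hN'
  have e : M.trace.re = ∑ i, ∑ j, ‖(Uᴴ * V) i j‖ ^ 2 * r i := by
    rw [h.trace_eq, Complex.ofReal_re]
    refine Finset.sum_congr rfl fun i _ => ?_
    rw [← Finset.sum_mul, h.sum_norm_sq_right g, one_mul]
  have e' : M'.trace.re = ∑ i, ∑ j, ‖(U'ᴴ * V') i j‖ ^ 2 * r' i := by
    rw [h'.trace_eq, Complex.ofReal_re]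
    refine Finset.sum_congr rfl fun i _ => ?_
    rw [← Finset.sum_mul, h'.sum_norm_sq_right g', one_mul]
  rw [(h.tensor h').relEnt_eq (g.tensor g'), h.relEnt_eq g, h'.relEnt_eq g', e, e',
    ← sum_sum_mul, ← sum_sum_mul, ← Finset.sum_add_distrib]
  rw [sum_tensor fun a b => ∑ y : (A₁ × A₂) × (B₁ × B₂), ‖((tensorMat U U')ᴴ * tensorMat V V')
      ((a.1, b.1), (a.2, b.2)) y‖ ^ 2 * (r a * r' b * (Real.log (r a * r' b) -
        Real.log (s (y.1.1, y.2.1) * s' (y.1.2, y.2.2))))]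
  refine Finset.sum_congr rfl fun a _ => ?_
  rw [← Finset.sum_add_distrib]
  refine Finset.sum_congr rfl fun b _ => ?_
  rw [← Finset.sum_add_distrib]
  rw [sum_tensor fun a' b' => ‖((tensorMat U U')ᴴ * tensorMat V V')
      ((a.1, b.1), (a.2, b.2)) ((a'.1, b'.1), (a'.2, b'.2))‖ ^ 2 * (r a * r' b *
        (Real.log (r a * r' b) - Real.log (s a' * s' b')))]
  refine Finset.sum_congr rfl fun a' _ => ?_
  rw [← Finset.sum_add_distrib]
  refine Finset.sum_congr rfl fun b' _ => ?_
  rw [tensorMat_conjTranspose, tensorMat_mul, tensorMat_apply, norm_mul]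
  dsimp only
  by_cases hr0 : r a = 0
  · simp [hr0]
  by_cases hr0' : r' b = 0
  · simp [hr0']
  by_cases hs0 : s a' = 0
  · rw [(h.kerLE_iff g).1 hk a a' hs0 hr0]
    simp
  by_cases hs0' : s' b' = 0
  · rw [(h'.kerLE_iff g').1 hk' b b' hs0' hr0']
    simp
  rw [Real.log_mul hr0 hr0', Real.log_mul hs0 hs0']
  ring

end Tensor

section Separable

variable {A B : Type} [Fintype A] [Fintype B]

/-- The cone of unnormalised separable states. -/
def IsSepMat {A B : Type} (M : Matrix (A × B) (A × B) ℂ) : Prop :=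
  ∃ (ζ : Type) (_ : Fintype ζ) (P : ζ → Matrix A A ℂ) (Q : ζ → Matrix B B ℂ),
    (∀ z, (P z).PosSemidef) ∧ (∀ z, (Q z).PosSemidef) ∧ M = ∑ z, P z ⊗ₖ Q z

/-- The maximally mixed state. -/
noncomputable def State.maxMixed (X : Type) [Fintype X] [DecidableEq X] [Nonempty X] : State X where
  mat := (((Fintype.card X : ℝ)⁻¹ : ℝ) : ℂ) • 1
  posSemidef := posSemidef_smul .one (by positivity)
  trace_eq_one := by
    rw [Matrix.trace_smul, Matrix.trace_one, smul_eq_mul]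
    push_cast
    exact inv_mul_cancel₀ (by exact_mod_cast Fintype.card_ne_zero)

theorem exists_state {X : Type} [Fintype X] [Nonempty X] {M : Matrix X X ℂ} (hM : M.PosSemidef) :
    ∃ ρ : State X, M = (M.trace.re : ℂ) • ρ.mat := by
  classical
  by_cases h : M.trace.re = 0
  · refine ⟨State.maxMixed X, ?_⟩
    rw [h, Complex.ofReal_zero, zero_smul]
    rw [← hM.trace_eq_zero_iff, trace_eq_re hM, h, Complex.ofReal_zero]
  · have h' : (M.trace.re : ℂ) ≠ 0 := by exact_mod_cast h
    refine ⟨⟨((M.trace.re⁻¹ : ℝ) : ℂ) • M,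
      posSemidef_smul hM (inv_nonneg.2 (trace_re_nonneg hM)), ?_⟩, ?_⟩
    · rw [Matrix.trace_smul, smul_eq_mul, Complex.ofReal_inv]
      nth_rw 2 [trace_eq_re hM]
      exact inv_mul_cancel₀ h'
    · rw [smul_smul, Complex.ofReal_inv, mul_inv_cancel₀ h', one_smul]

/-- A state in the separable cone is a convex combination of product states: each factor is
normalised, and the product of the two traces becomes the weight. -/
theorem isSeparable_iff (σ : State (A × B)) : IsSeparable σ ↔ IsSepMat σ.mat := by
  constructor
  · rintro ⟨m, p, α, β, hp, -, h⟩
    refine ⟨Fin m, inferInstance, fun i => (p i : ℂ) • (α i).mat, fun i => (β i).mat,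
      fun i => posSemidef_smul (α i).posSemidef (hp i), fun i => (β i).posSemidef, ?_⟩
    simp only [h, smul_kronecker]
  · rintro ⟨ζ, _, P, Q, hP, hQ, h⟩
    obtain ⟨a₀, b₀⟩ := σ.nonempty
    have : Nonempty A := ⟨a₀⟩
    have : Nonempty B := ⟨b₀⟩
    choose α hα using fun z => exists_state (hP z)
    choose β hβ using fun z => exists_state (hQ z)
    let e := (Fintype.equivFin ζ).symm
    refine ⟨Fintype.card ζ, fun i => (P (e i)).trace.re * (Q (e i)).trace.re, fun i => α (e i),
      fun i => β (e i), fun i => mul_nonneg (trace_re_nonneg (hP _)) (trace_re_nonneg (hQ _)), ?_, ?_⟩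
    · rw [Equiv.sum_comp e fun z => (P z).trace.re * (Q z).trace.re]
      have h1 := σ.trace_eq_one
      rw [h, Matrix.trace_sum] at h1
      have h2 : ∀ z, (P z ⊗ₖ Q z).trace = (((P z).trace.re * (Q z).trace.re : ℝ) : ℂ) := by
        intro z
        rw [trace_kronecker, trace_eq_re (hP z), trace_eq_re (hQ z)]
        simp
      rw [Finset.sum_congr rfl fun z _ => h2 z] at h1
      exact_mod_cast h1
    · rw [Equiv.sum_comp e fun z => (((P z).trace.re * (Q z).trace.re : ℝ) : ℂ) •
        ((α z).mat ⊗ₖ (β z).mat), h]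
      refine Finset.sum_congr rfl fun z _ => ?_
      conv_lhs => rw [hα z, hβ z]
      rw [smul_kronecker, kronecker_smul, smul_smul, Complex.ofReal_mul]

theorem IsSepMat.sum {A B ζ : Type} [Fintype ζ] {M : ζ → Matrix (A × B) (A × B) ℂ}
    (h : ∀ z, IsSepMat (M z)) : IsSepMat (∑ z, M z) := by
  choose Z hZ P Q hP hQ hM using h
  refine ⟨Σ z, Z z, inferInstance, fun y => P y.1 y.2, fun y => Q y.1 y.2, fun y => hP _ _,
    fun y => hQ _ _, ?_⟩
  rw [Fintype.sum_sigma]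
  exact Finset.sum_congr rfl fun z _ => hM z

theorem IsSepMat.zero {A B : Type} : IsSepMat (0 : Matrix (A × B) (A × B) ℂ) :=
  ⟨Empty, inferInstance, fun _ => 0, fun _ => 0, fun z => z.elim, fun z => z.elim, by simp⟩

theorem IsSepMat.smul {A B : Type} {M : Matrix (A × B) (A × B) ℂ} (h : IsSepMat M) {p : ℝ} (hp : 0 ≤ p) :
    IsSepMat ((p : ℂ) • M) := by
  obtain ⟨ζ, _, P, Q, hP, hQ, rfl⟩ := h
  refine ⟨ζ, inferInstance, fun z => (p : ℂ) • P z, Q, fun z => posSemidef_smul (hP z) hp, hQ, ?_⟩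
  simp only [smul_kronecker, Finset.smul_sum]

theorem IsSepMat.conj {A' B' : Type} [Fintype A'] [Fintype B'] {M : Matrix (A × B) (A × B) ℂ}
    (h : IsSepMat M) (a : Matrix A' A ℂ) (b : Matrix B' B ℂ) :
    IsSepMat ((a ⊗ₖ b) * M * (a ⊗ₖ b)ᴴ) := by
  obtain ⟨ζ, _, P, Q, hP, hQ, rfl⟩ := h
  refine ⟨ζ, inferInstance, fun z => a * P z * aᴴ, fun z => b * Q z * bᴴ,
    fun z => (hP z).mul_mul_conjTranspose_same _, fun z => (hQ z).mul_mul_conjTranspose_same _, ?_⟩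
  rw [Matrix.mul_sum, Matrix.sum_mul]
  simp only [conjTranspose_kronecker, mul_kronecker_mul]

theorem IsSepMat.tensor {A₂ B₂ : Type} [Fintype A₂] [Fintype B₂] {M : Matrix (A × B) (A × B) ℂ}
    {N : Matrix (A₂ × B₂) (A₂ × B₂) ℂ} (hM : IsSepMat M) (hN : IsSepMat N) :
    IsSepMat (tensorMat M N) := by
  obtain ⟨ζ, _, P, Q, hP, hQ, rfl⟩ := hM
  obtain ⟨ζ', _, P', Q', hP', hQ', rfl⟩ := hN
  refine ⟨ζ × ζ', inferInstance, fun z => P z.1 ⊗ₖ P' z.2, fun z => Q z.1 ⊗ₖ Q' z.2,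
    fun z => (hP _).kronecker (hP' _), fun z => (hQ _).kronecker (hQ' _), ?_⟩
  rw [Fintype.sum_prod_type]
  ext x y
  simp only [tensorMat_apply, Matrix.sum_apply, Finset.sum_mul_sum, kroneckerMap_apply]
  refine Finset.sum_congr rfl fun z _ => Finset.sum_congr rfl fun z' _ => ?_
  ring

theorem IsLOCC.isSepMat {I A' B' : Type} [DecidableEq I] [Fintype A'] [Fintype B']
    {Φ : I → Matrix (A × B) (A × B) ℂ → Matrix (A' × B') (A' × B') ℂ} (h : IsLOCC Φ) (i : I)
    {M : Matrix (A × B) (A × B) ℂ} (hM : IsSepMat M) : IsSepMat (Φ i M) := by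
  classical
  obtain ⟨Z, _, l, a, b, h1, -⟩ := h.exists_kraus
  rw [h1]
  refine IsSepMat.sum fun z => ?_
  split_ifs
  · exact hM.conj _ _
  · exact .zero

theorem isSeparable_maxMixed [DecidableEq A] [DecidableEq B] [Nonempty (A × B)] :
    IsSeparable (State.maxMixed (A × B)) := by
  rw [isSeparable_iff]
  refine IsSepMat.smul ⟨Unit, inferInstance, fun _ => 1, fun _ => 1, fun _ => .one, fun _ => .one,
    by simp⟩ (by positivity)

end Separable

section RelativeEntropyOfEntanglement

variable {A B : Type} [Fintype A] [Fintype B]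

theorem Diagonalizes.cfc_logb {X : Type} [Fintype X] [DecidableEq X] {U M : Matrix X X ℂ}
    {r : X → ℝ} (h : Diagonalizes U r M) :
    cfc (Real.logb 2) M = (((Real.log 2)⁻¹ : ℝ) : ℂ) • cfc Real.log M := by
  have : diagonal (fun i => ((Real.logb 2 (r i) : ℝ) : ℂ)) =
      (((Real.log 2)⁻¹ : ℝ) : ℂ) • diagonal (fun i => (Real.log (r i) : ℂ)) := by
    rw [← diagonal_smul]
    congr 1
    ext i
    simp [Real.logb, div_eq_inv_mul]
  rw [h.cfc_eq, h.cfc_eq, this, Matrix.mul_smul, Matrix.smul_mul]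

theorem relativeEntropy_of_kerLE {X : Type} [Fintype X] {ρ σ : State X}
    (hk : KerLE σ.mat ρ.mat) :
    relativeEntropy ρ σ = ((relEnt ρ.mat σ.mat / Real.log 2 : ℝ) : EReal) := by
  classical
  refine (if_pos hk).trans ?_
  congr 1
  obtain ⟨U, r, h, -⟩ := exists_diagonalizes ρ.posSemidef
  obtain ⟨V, s, h', -⟩ := exists_diagonalizes σ.posSemidef
  rw [relEnt, h.cfc_logb, h'.cfc_logb, ← smul_sub, Matrix.mul_smul, Matrix.trace_smul, smul_eq_mul,
    Complex.re_ofReal_mul, div_eq_inv_mul]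

theorem relativeEntropy_of_not_kerLE {X : Type} [Fintype X] {ρ σ : State X}
    (hk : ¬ KerLE σ.mat ρ.mat) : relativeEntropy ρ σ = ⊤ :=
  if_neg hk

theorem relativeEntropy_nonneg {X : Type} [Fintype X] (ρ σ : State X) :
    0 ≤ relativeEntropy ρ σ := by
  by_cases hk : KerLE σ.mat ρ.mat
  · rw [relativeEntropy_of_kerLE hk]
    have := trace_sub_trace_le_relEnt ρ.posSemidef σ.posSemidef hk
    rw [ρ.trace_eq_one, σ.trace_eq_one, sub_self] at this
    exact_mod_cast div_nonneg this (Real.log_nonneg one_le_two)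
  · rw [relativeEntropy_of_not_kerLE hk]
    exact le_top

/-- The infimum is finite, so that `EReal.toReal` does not produce a junk value. -/
theorem coe_relativeEntropyOfEntanglement (ρ : State (A × B)) :
    (relativeEntropyOfEntanglement A B ρ : EReal) =
      ⨅ (σ : State (A × B)) (_ : IsSeparable σ), relativeEntropy ρ σ := by
  classical
  refine EReal.coe_toReal ?_ ?_
  · have := ρ.nonempty
    refine ne_top_of_le_ne_top ?_ (iInf₂_le (State.maxMixed (A × B)) isSeparable_maxMixed)
    rw [relativeEntropy_of_kerLE]
    · exact EReal.coe_ne_top _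
    · intro v hv
      rw [State.maxMixed, smul_mulVec, smul_eq_zero, one_mulVec] at hv
      have hc : (((Fintype.card (A × B) : ℝ)⁻¹ : ℝ) : ℂ) ≠ 0 := by
        exact_mod_cast inv_ne_zero (Nat.cast_ne_zero.2 Fintype.card_ne_zero)
      rw [hv.resolve_left hc, mulVec_zero]
  · exact ne_bot_of_le_ne_bot EReal.zero_ne_bot (le_iInf₂ fun σ _ => relativeEntropy_nonneg ρ σ)

theorem relativeEntropyOfEntanglement_mul_log_le {ρ σ : State (A × B)} (hσ : IsSeparable σ)
    (hk : KerLE σ.mat ρ.mat) :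
    relativeEntropyOfEntanglement A B ρ * Real.log 2 ≤ relEnt ρ.mat σ.mat := by
  rw [← le_div_iff₀ (Real.log_pos one_lt_two), ← EReal.coe_le_coe_iff,
    ← relativeEntropy_of_kerLE hk, coe_relativeEntropyOfEntanglement]
  exact iInf₂_le σ hσ

theorem exists_relEnt_lt (ρ : State (A × B)) {ε : ℝ} (hε : 0 < ε) :
    ∃ σ : State (A × B), IsSeparable σ ∧ KerLE σ.mat ρ.mat ∧
      relEnt ρ.mat σ.mat < (relativeEntropyOfEntanglement A B ρ + ε) * Real.log 2 := by
  have : (⨅ (σ : State (A × B)) (_ : IsSeparable σ), relativeEntropy ρ σ) <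
      ((relativeEntropyOfEntanglement A B ρ + ε : ℝ) : EReal) := by
    rw [← coe_relativeEntropyOfEntanglement, EReal.coe_lt_coe_iff]
    exact lt_add_of_pos_right _ hε
  simp only [iInf_lt_iff] at this
  obtain ⟨σ, hσ, h⟩ := this
  have hk : KerLE σ.mat ρ.mat := by
    by_contra hk
    rw [relativeEntropy_of_not_kerLE hk] at h
    exact not_top_lt h
  rw [relativeEntropy_of_kerLE hk, EReal.coe_lt_coe_iff, div_lt_iff₀ (Real.log_pos one_lt_two)] at h
  exact ⟨σ, hσ, hk, h⟩

theorem relativeEntropyOfEntanglement_subadditive :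
    IsSubadditive relativeEntropyOfEntanglement := by
  intro A₁ B₁ A₂ B₂ _ _ _ _ ρ ρ'
  refine le_of_forall_pos_le_add fun ε hε => ?_
  obtain ⟨σ, hσ, hk, h⟩ := exists_relEnt_lt ρ (half_pos hε)
  obtain ⟨σ', hσ', hk', h'⟩ := exists_relEnt_lt ρ' (half_pos hε)
  rw [isSeparable_iff] at hσ hσ'
  have := relativeEntropyOfEntanglement_mul_log_le (ρ := ρ.tensor ρ') (σ := σ.tensor σ')
    ((isSeparable_iff _).2 (hσ.tensor hσ'))
    (hk.tensor ρ.posSemidef σ.posSemidef ρ'.posSemidef σ'.posSemidef hk')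
  have e : relEnt (ρ.tensor ρ').mat (σ.tensor σ').mat = _ :=
    relEnt_tensor ρ.posSemidef σ.posSemidef ρ'.posSemidef σ'.posSemidef hk hk'
  rw [e, ρ.trace_eq_one, ρ'.trace_eq_one, Complex.one_re, one_mul, mul_one] at this
  refine le_of_mul_le_mul_right ?_ (Real.log_pos one_lt_two)
  linarith

theorem relativeEntropyOfEntanglement_convex : IsConvex relativeEntropyOfEntanglement := by
  intro A B _ _ ρ ρ' τ t ht ht' hτ
  refine le_of_forall_pos_le_add fun ε hε => ?_
  obtain ⟨σ, hσ, hk, h⟩ := exists_relEnt_lt ρ hε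
  obtain ⟨σ', hσ', hk', h'⟩ := exists_relEnt_lt ρ' hε
  rw [isSeparable_iff] at hσ hσ'
  have ht'' : 0 ≤ 1 - t := sub_nonneg.2 ht'
  let M : Bool → Matrix (A × B) (A × B) ℂ := fun b =>
    if b then (t : ℂ) • ρ.mat else ((1 - t : ℝ) : ℂ) • ρ'.mat
  let N : Bool → Matrix (A × B) (A × B) ℂ := fun b =>
    if b then (t : ℂ) • σ.mat else ((1 - t : ℝ) : ℂ) • σ'.mat
  have hM : ∀ b, (M b).PosSemidef := by
    rintro (_ | _)
    · exact posSemidef_smul ρ'.posSemidef ht''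
    · exact posSemidef_smul ρ.posSemidef ht
  have hN : ∀ b, (N b).PosSemidef := by
    rintro (_ | _)
    · exact posSemidef_smul σ'.posSemidef ht''
    · exact posSemidef_smul σ.posSemidef ht
  have hkb : ∀ b, KerLE (N b) (M b) := by
    rintro (_ | _)
    · exact hk'.smul _
    · exact hk.smul _
  have hsep : IsSepMat (∑ b, N b) := by
    refine IsSepMat.sum ?_
    rintro (_ | _)
    · exact hσ'.smul ht''
    · exact hσ.smul ht
  let ω : State (A × B) := ⟨∑ b, N b, posSemidef_sum _ fun b _ => hN b, by
    simp [N, Matrix.trace_smul, State.trace_eq_one]⟩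
  have hτ' : τ.mat = ∑ b, M b := by
    rw [hτ]
    simp [M]
  have h1 := relativeEntropyOfEntanglement_mul_log_le (ρ := τ) (σ := ω) ((isSeparable_iff _).2 hsep)
    (by rw [hτ']; exact KerLE.sum hN hkb)
  have h2 := relEnt_sum_le hM hN hkb
  have e1 : relEnt (M true) (N true) = t * relEnt ρ.mat σ.mat :=
    relEnt_smul_self ρ.posSemidef σ.posSemidef hk ht
  have e2 : relEnt (M false) (N false) = (1 - t) * relEnt ρ'.mat σ'.mat :=
    relEnt_smul_self ρ'.posSemidef σ'.posSemidef hk' ht''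
  rw [hτ'] at h1
  rw [Fintype.sum_bool (fun b => relEnt (M b) (N b)), e1, e2] at h2
  refine le_of_mul_le_mul_right ?_ (Real.log_pos one_lt_two)
  have h3 := mul_le_mul_of_nonneg_left h.le ht
  have h4 := mul_le_mul_of_nonneg_left h'.le ht''
  have h5 : relEnt (∑ b, M b) ω.mat = relEnt (∑ b, M b) (∑ b, N b) := rfl
  linarith

/-- The logarithms of the probabilities contribute a classical relative entropy, which is
nonnegative after summation over the outcomes. -/
theorem prob_mul_relativeEntropyOfEntanglement_le (σ : State (A × B)) {p : ℝ} (hp : 0 ≤ p)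
    {T : Matrix (A × B) (A × B) ℂ} (hT : T.PosSemidef) (hsep : IsSepMat T)
    (hk : KerLE T ((p : ℂ) • σ.mat)) :
    p * relativeEntropyOfEntanglement A B σ * Real.log 2 ≤
      relEnt ((p : ℂ) • σ.mat) T + T.trace.re - p := by
  classical
  have hq := trace_re_nonneg hT
  rcases hp.eq_or_lt with rfl | hp
  · simpa [relEnt_zero_left] using hq
  have hp' : (p : ℂ) ≠ 0 := by exact_mod_cast hp.ne'
  have := σ.nonempty
  obtain ⟨τ, hτ⟩ := exists_state hT
  rcases hq.eq_or_lt with hq | hq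
  · exfalso
    -- by `hk`, a vanishing `T` would make `p • σ` vanish, but `p` is positive
    rw [← hq, Complex.ofReal_zero, zero_smul] at hτ
    have h0 : σ.mat = 0 := by
      refine Matrix.ext_of_mulVec_single fun j => ?_
      rw [zero_mulVec]
      have := hk (Pi.single j 1) (by rw [hτ, zero_mulVec])
      rw [smul_mulVec, smul_eq_zero] at this
      exact this.resolve_left hp'
    have := σ.trace_eq_one
    rw [h0, Matrix.trace_zero] at this
    exact zero_ne_one this
  set q := T.trace.re with hqdef
  have hτsep : IsSeparable τ := by
    rw [isSeparable_iff]
    have : τ.mat = ((q⁻¹ : ℝ) : ℂ) • T := by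
      rw [hτ, smul_smul, ← Complex.ofReal_mul, inv_mul_cancel₀ hq.ne', Complex.ofReal_one, one_smul]
    rw [this]
    exact hsep.smul (inv_nonneg.2 hq.le)
  rw [hτ] at hk ⊢
  have hk' := kerLE_of_smul hp' hk
  rw [relEnt_smul σ.posSemidef τ.posSemidef hk' hp hq, σ.trace_eq_one, Complex.one_re, one_mul]
  have h1 := mul_le_mul_of_nonneg_left (relativeEntropyOfEntanglement_mul_log_le hτsep hk') hp.le
  have h2 := sub_le_mul_log_sub_log hp hq
  rw [mul_add]
  linarith

theorem relativeEntropyOfEntanglement_fullyMonotone :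
    IsFullyMonotone relativeEntropyOfEntanglement := by
  classical
  intro A B A' B' I _ _ _ _ _ _ Φ hΦ ρ p σ h
  refine le_of_forall_pos_le_add fun ε hε => ?_
  obtain ⟨τ, hτ, hk, hlt⟩ := exists_relEnt_lt ρ hε
  rw [isSeparable_iff] at hτ
  obtain ⟨Z, _, l, a, b, h1, h2⟩ := hΦ.exists_kraus
  have hmono := sum_relEnt_instrument_le h2 l ρ.posSemidef τ.posSemidef hk
  simp only [← h1, h] at hmono
  have hker : ∀ i, KerLE (Φ i τ.mat) ((p i : ℂ) • (σ i).mat) := by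
    intro i
    rw [← h, h1, h1]
    refine KerLE.sum (fun z => ?_) fun z => ?_
    · split_ifs
      · exact τ.posSemidef.mul_mul_conjTranspose_same _
      · exact .zero
    · split_ifs
      · exact hk.conj τ.posSemidef _
      · exact fun v hv => hv
  have hi := Finset.sum_le_sum fun i (_ : i ∈ Finset.univ) =>
    prob_mul_relativeEntropyOfEntanglement_le (σ i) (hΦ.prob_nonneg h i)
      (hΦ.posSemidef i τ.posSemidef) (hΦ.isSepMat i hτ) (hker i)
  have htr := hΦ.sum_trace τ.mat
  rw [τ.trace_eq_one] at htr
  rw [Finset.sum_sub_distrib, Finset.sum_add_distrib, ← Finset.sum_mul, hΦ.sum_prob h,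
    ← Complex.re_sum, htr, Complex.one_re] at hi
  refine le_of_mul_le_mul_right ?_ (Real.log_pos one_lt_two)
  linarith

end RelativeEntropyOfEntanglement

end Entanglement

open Entanglement in
theorem proposition2 :
    (∀ E : BipartiteFunction,
      IsConvex E → IsSubadditive E → IsFullyMonotone E → IsAsymptoticallyContinuous E →
        RegularizationExists E ∧
        (IsFullyMonotone (regularization E) ↔ IsFullyAdditive (regularization E))) ∧
    (RegularizationExists relativeEntropyOfEntanglement ∧
      (IsFullyAdditive (regularization relativeEntropyOfEntanglement) ↔
        IsFullyMonotone (regularization relativeEntropyOfEntanglement))) :=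
  ⟨fun _ hC hS hM _ => ⟨hM.regularizationExists hS, hM.regularization_iff_additive hC hS⟩,
    relativeEntropyOfEntanglement_fullyMonotone.regularizationExists
      relativeEntropyOfEntanglement_subadditive,
    (relativeEntropyOfEntanglement_fullyMonotone.regularization_iff_additive
      relativeEntropyOfEntanglement_convex relativeEntropyOfEntanglement_subadditive).symm⟩
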